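/- **Setting.** Let $\mu$ be a Markov kernel on $\mathbb{R}^d$ whose laws $\mu_x$ have Lebesgue densities, $\mu_x(dz)=\rho(x,z)\,dz$ with $\rho\ge 0$ jointly measurable. For $\varepsilon>0$ let $x^\varepsilon$ be the chain $x^\varepsilon(0)=x_0$, $x^\varepsilon((n+1)\varepsilon)=x^\varepsilon(n\varepsilon)+\varepsilon Z_n$, where $Z_n$ has conditional law $\mu_{x^\varepsilon(n\varepsilon)}$ given the past. For $n\ge1$ let $p^\varepsilon_n$ denote the density of $x^\varepsilon(n\varepsilon)$ given by $p^\varepsilon_1(x)=\varepsilon^{-d}\rho(x_0,(x-x_0)/\varepsilon)$ and the Kolmogorov forward equation $p^\varepsilon_{n+1}(x)=\int p^\varepsilon_n(x-\varepsilon z)\,\rho(x-\varepsilon z,z)\,dz$. Put $H(x,\alpha)=\ln\int e^{\alpha\cdot z}\mu_x(dz)$ and $L(x,\beta)=\sup_\alpha[\alpha\cdot\beta-H(x,\alpha)]$. Let $I_{[0,T]}(\phi)=\int_0^T L(\phi,\dot\phi)\,dt$ if $\phi$ is absolutely continuous on $[0,T]$, and $\infty$ otherwise; let $S(x,t|x_0)=\inf\{I_{[0,t]}(\phi):\phi(0)=x_0,\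 \phi(t)=x\}$. An *optimal path* from $x_0$ to $x_T$ in time $T$ is a minimizer $\phi$ with $I_{[0,T]}(\phi)=S(x_T,T|x_0)<\infty$. Fix $T>0$, $x_0$, $x_T$ and an optimal path $\phi$ from $x_0$ to $x_T$ in time $T$. For $T^*\in(0,T)$ and $\delta_0>0$ let $\Sigma=\Sigma_{\delta_0,T^*}=\bigcup_{t\in[T-T^*,T]}B_{\delta_0}(\phi(t))$, with $B_r(x)$ the open ball. Write $N=\lfloor T/\varepsilon\rfloor$, $\Delta=T-N\varepsilon$, and consider the grid times $t_m=\Delta+m\varepsilon$. For $m\le N-2$ the reversed jump law is $$\bar\mu^\varepsilon_{x,t_m}(dz)=\frac{p^\varepsilon_{N-m-1}(x+\varepsilon z)\,\rho(x+\varepsilon z,-z)}{p^\varepsilon_{N-m}(x)}\,dz\qquad(0/0=0),$$ and for $m=N-1$ it is the point mass at $(x_0-x)/\varepsilon$. Put $\bar b^\varepsilon(x,t_m)=\int z\,\bar\mu^\varepsilon_{x,t_m}(dz)$ and $\bar b(x,t)=-\nabla_\alpha H\big(x,\nabla_xS(x,T-t|x_0)\big)$. The reversed process $\bar x^\varepsilon$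 is the left-continuous step process that is constant on $[0,\Delta]$ and on each $(t_m,t_{m+1}]$, starts from $\bar x^\varepsilon(0)=x_T$ a.s., and whose jump $\varepsilon^{-1}(\bar x^\varepsilon(t_{m+1})-\bar x^\varepsilon(t_m))$ has conditional law $\bar\mu^\varepsilon_{\bar x^\varepsilon(t_m),t_m}$ given $\bar x^\varepsilon(t_0),\dots,\bar x^\varepsilon(t_m)$, for $0\le m<N$. **Assumptions.** 1. There is a finite, nonnegative, convex $\bar H$ with $\bar H(0)=0$ and $H(x,\alpha)\le\bar H(\alpha)$ for all $x,\alpha$. The function $L$ is finite everywhere and $C^2$ in $\beta$, and for every $R>0$ there are $M_R,m_R>0$ such that for all $x$ and $\lambda$ and all $|\beta|\le R$: $L(x,\beta)\le M_R$, $|\nabla_\beta L(x,\beta)|\le M_R$ and $\sum_{i,j}\partial_{\beta_i}\partial_{\beta_j}L(x,\beta)\lambda_i\lambda_j\ge m_R|\lambda|^2$. Moreover $\sup_{|x-y|<\delta}\sup_\beta\frac{L(x,\beta)-L(y,\beta)}{1+L(y,\beta)}\to0$ as $\delta\to0^+$. 2. $H$ is $C^2$ in $(x,\alpha)$, and $\phi$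 is a proper subarc of another optimal path: for some $\gamma_0>0$ there is an optimal path $\psi$ on $[0,T+2\gamma_0]$ (between its own end points) with $\phi(t)=\psi(t+\gamma_0)$ for all $t\in[0,T]$. 3. For every $T^*\in(0,T)$ there is $\delta_0>0$ such that $(x,t)\mapsto S(x,t|x_0)$ is $C^2$ on $\Sigma\times[T-T^*,T]$ and, for all sufficiently small $\varepsilon$ and all $n$ with $n\varepsilon\in[T-T^*,T]$, the density $p^\varepsilon_n$ is continuous, positive and finite on $\Sigma$. 4. For every $T^*\in(0,T)$ there is $\delta_0>0$ such that (a) for some finite $G_1$ and all small $\varepsilon$, $\int|z|\,\bar\mu^\varepsilon_{x,t}(dz)\le G_1$ for all $x\in\Sigma$ and all grid times $t\in[0,T^*]$; (b) $\bar b^\varepsilon(x,t)-\bar b(x,t)\to0$ as $\varepsilon\to0$, uniformly over $x\in\Sigma$ and grid times $t\in[0,T^*]$; (c) for some $\varkappa_1\in(0,1]$, some finite $G_2$ and all small $\varepsilon$, $\int|z-\bar b^\varepsilon(x,t)|^{1+\varkappa_1}\bar\mu^\varepsilon_{x,t}(dz)\le G_2$ for all $x\in\Sigma$ and all grid times $t\in[0,T^*]$.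 **Conclusion.** For every $T^*\in(0,T)$ and every $\delta>0$, $$\lim_{\varepsilon\to0}P^\varepsilon\Big(\sup_{t\in[0,T^*]}\big|\bar x^\varepsilon(t)-\phi(T-t)\big|>\delta\Big)=0 .$$ -/

import Mathlib

open MeasureTheory ProbabilityTheory Set Filter Topology
open scoped ENNReal NNReal InnerProductSpace

namespace JumpReversal

noncomputable section

/-- The state space `ℝ^d` with its Euclidean norm. -/
abbrev E (d : ℕ) : Type := EuclideanSpace ℝ (Fin d)

variable {d : ℕ}

/-! ### Hamiltonian, Lagrangian, action -/

/-- `H(x, α) = ln ∫ e^{α·z} μ_x(dz)`, with value `⊤` when the integral diverges. -/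
def hamiltonian (μ : Kernel (E d) (E d)) (x α : E d) : EReal :=
  ENNReal.log (∫⁻ z, ENNReal.ofReal (Real.exp ⟪α, z⟫_ℝ) ∂(μ x))

/-- `L(x, β) = sup_α [α·β - H(x, α)]`. -/
def lagrangian (μ : Kernel (E d) (E d)) (x β : E d) : EReal :=
  ⨆ α : E d, ((⟪α, β⟫_ℝ : ℝ) : EReal) - hamiltonian μ x α

/-- The Hamiltonian as a real number (meaningful where it is finite). -/
def hamiltonianR (μ : Kernel (E d) (E d)) (x α : E d) : ℝ := (hamiltonian μ x α).toReal

/-- The Lagrangian as a real number (meaningful where it is finite). -/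
def lagrangianR (μ : Kernel (E d) (E d)) (x β : E d) : ℝ := (lagrangian μ x β).toReal

open Classical in
/-- The normalized action `I_{[0,T]}(φ)`: the integral of `L(φ, φ')` over `[0,T]` if `φ` is absolutely
continuous on `[0,T]`, and `∞` otherwise. (`L ≥ 0`, by taking `α = 0` in the supremum.) -/
def action (μ : Kernel (E d) (E d)) (T : ℝ) (φ : ℝ → E d) : ℝ≥0∞ :=
  if AbsolutelyContinuousOnInterval φ 0 T then
    ∫⁻ t in Icc 0 T, (lagrangian μ (φ t) (deriv φ t)).toENNReal
  else ⊤

/-- The quasi-potential `S(x, t | x₀)`, the infimum of the action over paths from `x₀` to `x` in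
time `t`. -/
def quasiPotential (μ : Kernel (E d) (E d)) (x₀ x : E d) (t : ℝ) : ℝ≥0∞ :=
  ⨅ (φ : ℝ → E d) (_ : φ 0 = x₀) (_ : φ t = x), action μ t φ

/-- `S(x, t | x₀)` as a real number (meaningful where it is finite). -/
def quasiPotentialR (μ : Kernel (E d) (E d)) (x₀ x : E d) (t : ℝ) : ℝ :=
  (quasiPotential μ x₀ x t).toReal

/-- `φ` (restricted to `[0,T]`) is a non-stationary optimal path connecting `x₀` with `xT` in the
time span `T`. -/
structure IsNOP (μ : Kernel (E d) (E d)) (T : ℝ) (x₀ xT : E d) (φ : ℝ → E d) : Prop where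
  start : φ 0 = x₀
  finish : φ T = xT
  minimal : action μ T φ = quasiPotential μ x₀ xT T
  finite : action μ T φ < ⊤

/-- The path `φ` on `[0,T]` is a proper subarc of a longer non-stationary optimal path. -/
def IsProperSubarc (μ : Kernel (E d) (E d)) (T : ℝ) (φ : ℝ → E d) : Prop :=
  ∃ γ₀ : ℝ, 0 < γ₀ ∧ ∃ ψ : ℝ → E d,
    IsNOP μ (T + 2 * γ₀) (ψ 0) (ψ (T + 2 * γ₀)) ψ ∧ ∀ t ∈ Icc 0 T, φ t = ψ (t + γ₀)

/-- The modulus of continuity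
`ΔL(δ) = sup_{|x-y|<δ} sup_β (L(x,β) - L(y,β)) / (1 + L(y,β))`. -/
def lagrangianModulus (μ : Kernel (E d) (E d)) (δ : ℝ) : EReal :=
  ⨆ (x : E d) (y : E d) (_ : ‖x - y‖ < δ) (β : E d),
    (((lagrangianR μ x β - lagrangianR μ y β) / (1 + lagrangianR μ y β) : ℝ) : EReal)

/-- The conditions on `H` and `L` under which the large deviation principle is formulated. -/
structure LDPConditions (μ : Kernel (E d) (E d)) : Prop where
  hamiltonian_le : ∃ Hbar : E d → ℝ, (∀ α, 0 ≤ Hbar α) ∧ ConvexOn ℝ univ Hbar ∧ Hbar 0 = 0 ∧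
    ∀ x α, hamiltonian μ x α ≤ (Hbar α : EReal)
  lagrangian_finite : ∀ x β, lagrangian μ x β ≠ ⊤
  /-- The derivatives of `L` in `β` which occur in the next condition exist classically. -/
  lagrangian_contDiff : ∀ x, ContDiff ℝ 2 (lagrangianR μ x)
  lagrangian_bounds : ∀ R : ℝ, 0 < R → ∃ M m : ℝ, 0 < M ∧ 0 < m ∧
    ∀ x β : E d, ‖β‖ ≤ R →
      lagrangianR μ x β ≤ M ∧ ‖gradient (lagrangianR μ x) β‖ ≤ M ∧
      ∀ v : E d, m * ‖v‖ ^ 2 ≤ iteratedFDeriv ℝ 2 (lagrangianR μ x) β ![v, v]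
  modulus_tendsto : Tendsto (lagrangianModulus μ) (𝓝[>] 0) (𝓝 0)

/-- The tube `⋃_{t ∈ [t₁,t₂]} B_δ(φ(t))`. -/
def tube (φ : ℝ → E d) (δ t₁ t₂ : ℝ) : Set (E d) := ⋃ t ∈ Icc t₁ t₂, Metric.ball (φ t) δ

/-! ### The forward chain and its densities -/

/-- The law of `x^ε(nε)`, where `x^ε(0) = x₀` and `x^ε((n+1)ε) = x^ε(nε) + ε Z_n` with
`Z_n ∼ μ_{x^ε(nε)}`. -/
def forwardLaw (μ : Kernel (E d) (E d)) (ε : ℝ) (x₀ : E d) : ℕ → Measure (E d)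
  | 0 => Measure.dirac x₀
  | n + 1 => ((forwardLaw μ ε x₀ n) ⊗ₘ μ).map (fun p => p.1 + ε • p.2)

/-- The density `p^ε(x, nε | x₀, 0)` for `n ≥ 1`, when `μ_y(dz) = ρ(y, z) dz`: the density of
`x₀ + ε Z`, `Z ∼ μ_{x₀}`, for `n = 1`, and then the Kolmogorov forward equation
`p^ε(x, (n+1)ε) = ∫ p^ε(x - εz, nε) μ_{x-εz}(dz)`. (For `n = 0` the law is a point mass; the value
`0` is a placeholder.) -/
def forwardDensity (ρ : E d → E d → ℝ≥0∞) (ε : ℝ) (x₀ : E d) : ℕ → E d → ℝ≥0∞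
  | 0, _ => 0
  | 1, x => ENNReal.ofReal (|ε ^ d|⁻¹) * ρ x₀ (ε⁻¹ • (x - x₀))
  | n + 2, x => ∫⁻ z, forwardDensity ρ ε x₀ (n + 1) (x - ε • z) * ρ (x - ε • z) z

/-- The reversed jump law `μ̄_{x,t}(dz) = p^ε(x+εz, T-t-ε | x₀,0) μ_{x+εz}(-dz) / p^ε(x, T-t | x₀,0)`
at the grid time `t` at which `n` forward steps remain (so `p^ε(·, T-t | x₀,0)` is the density after
`n` steps), with `0/0 = 0`. For `n = 1` the numerator contains the point mass at `x₀`, so the only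
possible jump leads back to `x₀`; `n = 0` is a placeholder. -/
def reversedJumpLaw (ρ : E d → E d → ℝ≥0∞) (ε : ℝ) (x₀ : E d) : ℕ → E d → Measure (E d)
  | 0, _ => 0
  | 1, x => Measure.dirac (ε⁻¹ • (x₀ - x))
  | n + 2, x => (volume : Measure (E d)).withDensity fun z =>
      forwardDensity ρ ε x₀ (n + 1) (x + ε • z) * ρ (x + ε • z) (-z) /
        forwardDensity ρ ε x₀ (n + 2) x

lemma map_addHaar_smul_eq {ε : ℝ} (hε : ε ≠ 0) :
    Measure.map (fun x : E d => ε • x) volume =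
      ENNReal.ofReal (|ε ^ d|⁻¹) • (volume : Measure (E d)) := by
  rw [Measure.map_addHaar_smul (volume : Measure (E d)) hε]
  simp [abs_inv]

lemma measurable_forwardDensity {ρ : E d → E d → ℝ≥0∞} (hρ : Measurable (Function.uncurry ρ))
    (ε : ℝ) (x₀ : E d) (n : ℕ) : Measurable (forwardDensity ρ ε x₀ n) := by
  have key : ∀ n, Measurable (forwardDensity ρ ε x₀ (n + 1)) := by
    intro n
    induction n with
    | zero =>
      have h : Measurable fun x : E d => ρ x₀ (ε⁻¹ • (x - x₀)) :=
        hρ.comp (measurable_const.prodMk (by fun_prop))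
      exact h.const_mul _
    | succ n ih =>
      have h : Measurable fun q : E d × E d =>
          forwardDensity ρ ε x₀ (n + 1) (q.1 - ε • q.2) * ρ (q.1 - ε • q.2) q.2 :=
        (ih.comp (by fun_prop)).mul (hρ.comp ((by fun_prop : Measurable fun q : E d × E d =>
          q.1 - ε • q.2).prodMk measurable_snd))
      exact h.lintegral_prod_right'
  cases n with
  | zero => exact measurable_const
  | succ n => exact key n

/-- `forwardDensity` is the Lebesgue density of the law of the forward chain. -/
lemma forwardLaw_succ {μ : Kernel (E d) (E d)} [IsMarkovKernel μ] {ρ : E d → E d → ℝ≥0∞}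
    (hρ : Measurable (Function.uncurry ρ))
    (hμ : ∀ x, μ x = (volume : Measure (E d)).withDensity (ρ x))
    {ε : ℝ} (hε : ε ≠ 0) (x₀ : E d) (n : ℕ) :
    forwardLaw μ ε x₀ (n + 1) =
      (volume : Measure (E d)).withDensity (forwardDensity ρ ε x₀ (n + 1)) := by
  have hρx : ∀ x, Measurable (ρ x) := fun x => hρ.comp (measurable_const.prodMk measurable_id)
  have hpm := measurable_forwardDensity hρ ε x₀
  have hsf : ∀ n, SFinite (forwardLaw μ ε x₀ n) := by
    intro n
    induction n with
    | zero => rw [forwardLaw]; infer_instance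
    | succ n ih => rw [forwardLaw]; infer_instance
  have hgen : ∀ (n : ℕ) (f : E d → ℝ≥0∞), Measurable f → ∫⁻ x, f x ∂(forwardLaw μ ε x₀ (n + 1)) =
      ∫⁻ y, (∫⁻ z, ρ y z * f (y + ε • z)) ∂(forwardLaw μ ε x₀ n) := by
    intro n f hf
    have := hsf n
    have hstep : Measurable fun p : E d × E d => p.1 + ε • p.2 := by fun_prop
    have hfs : Measurable fun p : E d × E d => f (p.1 + ε • p.2) := hf.comp hstep
    rw [forwardLaw, lintegral_map hf hstep, Measure.lintegral_compProd hfs]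
    refine lintegral_congr fun y => ?_
    rw [hμ y]
    exact lintegral_withDensity_eq_lintegral_mul _ (hρx y)
      (hf.comp (by fun_prop : Measurable fun z : E d => y + ε • z))
  have hmeas : ∀ f : E d → ℝ≥0∞, Measurable f →
      Measurable fun q : E d × E d => ρ q.1 q.2 * f (q.1 + ε • q.2) := fun f hf =>
    hρ.mul (hf.comp (by fun_prop : Measurable fun q : E d × E d => q.1 + ε • q.2))
  have hint : ∀ f : E d → ℝ≥0∞, Measurable f →
      Measurable fun y : E d => ∫⁻ z, ρ y z * f (y + ε • z) :=
    fun f hf => (hmeas f hf).lintegral_prod_right'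
  induction n with
  | zero =>
    refine Measure.ext_of_lintegral _ fun f hf => ?_
    rw [hgen 0 f hf, forwardLaw, lintegral_dirac' x₀ (hint f hf),
      lintegral_withDensity_eq_lintegral_mul _ (hpm 1) hf]
    simp only [Pi.mul_apply, forwardDensity]
    have hscale := map_addHaar_smul_eq (d := d) hε
    have h1 : ∫⁻ z, ρ x₀ z * f (x₀ + ε • z) =
        ∫⁻ z, (fun x => ρ x₀ (ε⁻¹ • x) * f (x₀ + x)) (ε • z) := by
      simp [smul_smul, inv_mul_cancel₀ hε]
    have hg : Measurable fun x : E d => ρ x₀ (ε⁻¹ • x) * f (x₀ + x) :=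
      ((hρx x₀).comp (measurable_const_smul _)).mul (hf.comp (measurable_const_add _))
    rw [h1, ← lintegral_map (μ := (volume : Measure (E d))) hg (measurable_const_smul ε), hscale,
      lintegral_smul_measure, smul_eq_mul, ← lintegral_sub_right_eq_self _ x₀,
      ← lintegral_const_mul' _ _ ENNReal.ofReal_ne_top]
    refine lintegral_congr fun x => ?_
    simp [mul_assoc]
  | succ n ih =>
    refine Measure.ext_of_lintegral _ fun f hf => ?_
    rw [hgen (n + 1) f hf, ih, lintegral_withDensity_eq_lintegral_mul _ (hpm _)
      (hint f hf), lintegral_withDensity_eq_lintegral_mul _ (hpm _) hf]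
    have hA : Measurable fun q : E d × E d =>
        forwardDensity ρ ε x₀ (n + 1) q.1 * (ρ q.1 q.2 * f (q.1 + ε • q.2)) :=
      ((hpm _).comp measurable_fst).mul (hmeas f hf)
    have hB : Measurable fun q : E d × E d => forwardDensity ρ ε x₀ (n + 1) (q.1 - ε • q.2) *
        ρ (q.1 - ε • q.2) q.2 := by
      have h : Measurable fun q : E d × E d => q.1 - ε • q.2 := by fun_prop
      exact ((hpm _).comp h).mul (hρ.comp (h.prodMk measurable_snd))
    calc ∫⁻ y, forwardDensity ρ ε x₀ (n + 1) y * ∫⁻ z, ρ y z * f (y + ε • z)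
        = ∫⁻ y, ∫⁻ z, forwardDensity ρ ε x₀ (n + 1) y * (ρ y z * f (y + ε • z)) := by
          refine lintegral_congr fun y => ?_
          exact (lintegral_const_mul _ ((hmeas f hf).comp measurable_prodMk_left)).symm
      _ = ∫⁻ z, ∫⁻ y, forwardDensity ρ ε x₀ (n + 1) y * (ρ y z * f (y + ε • z)) :=
          lintegral_lintegral_swap hA.aemeasurable
      _ = ∫⁻ z, ∫⁻ x, forwardDensity ρ ε x₀ (n + 1) (x - ε • z) * ρ (x - ε • z) z * f x := by
          refine lintegral_congr fun z => ?_
          rw [← lintegral_sub_right_eq_self _ (ε • z)]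
          simp [mul_assoc]
      _ = ∫⁻ x, ∫⁻ z, forwardDensity ρ ε x₀ (n + 1) (x - ε • z) * ρ (x - ε • z) z * f x :=
          (lintegral_lintegral_swap (hB.mul (hf.comp measurable_fst)).aemeasurable).symm
      _ = ∫⁻ x, forwardDensity ρ ε x₀ (n + 2) x * f x := by
          refine lintegral_congr fun x => ?_
          exact lintegral_mul_const _ (hB.comp measurable_prodMk_left)

/-- Where the density in its denominator is positive and finite, the reversed jump law is a
probability measure. -/
lemma reversedJumpLaw_univ {ρ : E d → E d → ℝ≥0∞} (ε : ℝ) (x₀ x : E d) (n : ℕ)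
    (h0 : forwardDensity ρ ε x₀ (n + 2) x ≠ 0) (h1 : forwardDensity ρ ε x₀ (n + 2) x ≠ ⊤) :
    reversedJumpLaw ρ ε x₀ (n + 2) x univ = 1 := by
  simp only [reversedJumpLaw, withDensity_apply _ MeasurableSet.univ, Measure.restrict_univ,
    div_eq_mul_inv]
  rw [lintegral_mul_const' _ _ (ENNReal.inv_ne_top.2 h0), ← lintegral_neg_eq_self]
  have : ∫⁻ z, forwardDensity ρ ε x₀ (n + 1) (x + ε • -z) * ρ (x + ε • -z) (- -z) =
      forwardDensity ρ ε x₀ (n + 2) x := by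
    simp [forwardDensity, sub_eq_add_neg]
  rw [this, ENNReal.mul_inv_cancel h0 h1]

/-! ### The reversed process -/

/-- `X 0, X 1, …` are the values at the grid times `Δ, Δ + ε, …, Δ + Nε = T`, `N = ⌊T/ε⌋`, of a
reversed process which starts from `xT`: given the past up to time `Δ + mε`, the jump
`ε⁻¹ (X (m+1) - X m)` has law `μ̄_{X m, Δ+mε}`. At time `Δ + mε` there remain `N - m` forward steps. -/
structure IsReversedChain {Ω : Type*} [MeasurableSpace Ω] (P : Measure Ω)
    (ρ : E d → E d → ℝ≥0∞) (T ε : ℝ) (x₀ xT : E d) (X : ℕ → Ω → E d) : Prop where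
  measurable : ∀ m, Measurable (X m)
  initial : ∀ᵐ ω ∂P, X 0 ω = xT
  jump : ∀ m < ⌊T / ε⌋₊, ∀ A : Set Ω,
    MeasurableSet[⨆ (i : ℕ) (_ : i ≤ m), MeasurableSpace.comap (X i) inferInstance] A →
    ∀ D : Set (E d), MeasurableSet D →
      P (A ∩ {ω | ε⁻¹ • (X (m + 1) ω - X m ω) ∈ D}) =
        ∫⁻ ω in A, reversedJumpLaw ρ ε x₀ (⌊T / ε⌋₊ - m) (X m ω) D ∂P

/-- The offset `Δ = T - ⌊T/ε⌋ ε`. -/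
def offset (T ε : ℝ) : ℝ := T - ⌊T / ε⌋₊ * ε

/-- The left-continuous step process with values `X m` at the grid times: it equals `X 0` on
`[0, Δ]` and `X ⌈(t-Δ)/ε⌉` on `(Δ, T]` (the ceiling is `0` for `t ≤ Δ`). -/
def reversedPath {Ω : Type*} (T ε : ℝ) (X : ℕ → Ω → E d) (t : ℝ) (ω : Ω) : E d :=
  X ⌈(t - offset T ε) / ε⌉₊ ω

/-- The mean drift `b̄^ε(x, Δ+mε) = ∫ z μ̄_{x,Δ+mε}(dz)` of the reversed chain. -/
def reversedDrift (ρ : E d → E d → ℝ≥0∞) (T ε : ℝ) (x₀ : E d) (m : ℕ) (x : E d) : E d :=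
  ∫ z, z ∂(reversedJumpLaw ρ ε x₀ (⌊T / ε⌋₊ - m) x)

/-- The limiting drift `b̄(x, t) = -∇_α H(x, ∇_x S(x, T-t | x₀))`. -/
def limitDrift (μ : Kernel (E d) (E d)) (T : ℝ) (x₀ x : E d) (t : ℝ) : E d :=
  -gradient (hamiltonianR μ x) (gradient (fun y => quasiPotentialR μ x₀ y (T - t)) x)

end

end JumpReversal

/-!
Two ingredients give the law of large numbers: the reversed optimal path solves the ordinary
differential equation driven by the limiting drift, and a Lyapunov function keeps the reversed chain
close to that solution.

*The path.* By concatenation of paths, initial pieces of `φ` are optimal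
(`IsNOP.quasiPotential_eq`), so `S(φ s, s | x₀)` is the integral of `L(φ, φ')` over `[0, s]`.
Continuing `φ` from `φ s` with an arbitrary constant velocity `β` gives the Hamilton–Jacobi inequality
`∂_t S + ⟪∇_x S, β⟫ ≤ L(φ s, β)` (`IsNOP.fderiv_quasiPotentialR_le`), and differentiation along `φ`
shows that `β = φ' s` gives equality for almost every `s`. Thus `φ' s` maximizes
`⟪∇_x S, ·⟫ - L(φ s, ·)`, which by convex duality means `φ' s = ∇_α H(φ s, ∇_x S(φ s, s | x₀))`
(`LDPConditions.gradient_hamiltonianR_eq`, `IsNOP.ae_hasDerivAt`). The right-hand side is continuous in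
`s`, so `φ` is `C¹` near its end and has a uniform first order expansion (`IsNOP.exists_expansion`).
Since `H` and `S` are `C²`, the drift is Lipschitz in space near the path
(`exists_lipschitz_near_curve`).

*The chain.* Let `V(y) = √(1 + |y|²) - 1`. As `V` is smooth and of linear growth, its second order
Taylor remainder at a centred jump `ε z` is at most `2 ε^{1+κ} |z|^{1+κ}`
(`lyapunov_add_le`), which the assumed moments control. Together with the two facts above, one jump
from `x` near the path multiplies `V` of the displacement from the path by at most `(1 + ε C)²` in
mean, up to an error `o(ε)` (`lintegral_lyapunov_step_le`). Stopping at the exit from a tube of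
radius `r` and iterating over the `O(1/ε)` steps bounds `V(r)` times the exit probability by a quantity
that tends to `0` (`IsReversedChain.measure_stayEvent_compl_le`, `IsReversedChain.exit_le`).
Because the exit event is counted through `V` itself, no maximal inequality is needed.
-/

namespace JumpReversal

/-! ### Duality between the Hamiltonian and the Lagrangian -/

section Legendre

variable {d : ℕ} {μ : Kernel (E d) (E d)}

/-- A differentiable convex function lies above its tangent planes. -/
lemma _root_.ConvexOn.inner_gradient_le {F : Type*} [NormedAddCommGroup F] [InnerProductSpace ℝ F]
    [CompleteSpace F] {f : F → ℝ} (hf : ConvexOn ℝ univ f) {p : F} (hd : DifferentiableAt ℝ f p)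
    (q : F) : f p + ⟪gradient f p, q - p⟫_ℝ ≤ f q := by
  have hline : HasDerivAt (fun t : ℝ => p + t • (q - p)) (q - p) 0 := by
    simpa using ((hasDerivAt_id (0 : ℝ)).smul_const (q - p)).const_add p
  have hd' : HasFDerivAt f (fderiv ℝ f p) (p + (0 : ℝ) • (q - p)) := by
    simpa using hd.hasFDerivAt
  have hcomp : HasDerivAt (fun t : ℝ => f (p + t • (q - p))) (fderiv ℝ f p (q - p)) 0 :=
    hd'.comp_hasDerivAt 0 hline
  have hconv : ConvexOn ℝ univ fun t : ℝ => f (p + t • (q - p)) := by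
    refine ⟨convex_univ, fun s _ t _ a b ha hb hab => ?_⟩
    have := hf.2 (mem_univ (p + s • (q - p))) (mem_univ (p + t • (q - p))) ha hb hab
    refine le_trans (le_of_eq ?_) this
    refine congrArg f ?_
    have hb' : b = 1 - a := by linarith
    subst hb'
    simp only [smul_eq_mul]
    module
  have := hconv.deriv_le_slope (mem_univ 0) (mem_univ 1) one_pos hcomp.differentiableAt
  rw [hcomp.deriv] at this
  simp only [slope_def_field, one_smul, zero_smul, add_zero, add_sub_cancel, sub_zero, div_one]
    at this
  have hg : ⟪gradient f p, q - p⟫_ℝ = fderiv ℝ f p (q - p) := by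
    simp [gradient]
  rw [hg]
  linarith

lemma LDPConditions.hamiltonian_ne_top (h : LDPConditions μ) (x α : E d) :
    hamiltonian μ x α ≠ ⊤ := by
  obtain ⟨Hbar, -, -, -, hle⟩ := h.hamiltonian_le
  exact ne_top_of_le_ne_top (EReal.coe_ne_top _) (hle x α)

lemma differentiable_hamiltonianR
    (hH : ContDiff ℝ 2 fun p : E d × E d => hamiltonianR μ p.1 p.2) (x : E d) :
    Differentiable ℝ (hamiltonianR μ x) :=
  (hH.differentiable (by norm_num)).comp ((differentiable_const x).prodMk differentiable_id)

variable [IsMarkovKernel μ]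

lemma lintegral_exp_ne_zero (x α : E d) :
    ∫⁻ z, ENNReal.ofReal (Real.exp ⟪α, z⟫_ℝ) ∂(μ x) ≠ 0 := by
  rw [Ne, lintegral_eq_zero_iff (by fun_prop)]
  intro h
  have : ∀ᵐ z ∂(μ x), False := by
    filter_upwards [h] with z hz
    simp only [Pi.zero_apply, ENNReal.ofReal_eq_zero] at hz
    exact absurd hz (not_le.2 (Real.exp_pos _))
  rw [ae_iff] at this
  simp at this

lemma LDPConditions.coe_hamiltonianR (h : LDPConditions μ) (x α : E d) :
    (hamiltonianR μ x α : EReal) = hamiltonian μ x α := by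
  refine EReal.coe_toReal (h.hamiltonian_ne_top x α) ?_
  rw [hamiltonian, Ne, ENNReal.log_eq_bot_iff]
  exact lintegral_exp_ne_zero x α

lemma lagrangian_nonneg (x β : E d) : 0 ≤ lagrangian μ x β := by
  refine le_iSup_of_le 0 ?_
  simp [hamiltonian]

lemma LDPConditions.coe_lagrangianR (h : LDPConditions μ) (x β : E d) :
    (lagrangianR μ x β : EReal) = lagrangian μ x β :=
  EReal.coe_toReal (h.lagrangian_finite x β)
    (ne_bot_of_le_ne_bot EReal.zero_ne_bot (lagrangian_nonneg x β))

lemma lagrangianR_nonneg (x β : E d) : 0 ≤ lagrangianR μ x β :=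
  EReal.toReal_nonneg (lagrangian_nonneg x β)

lemma LDPConditions.toENNReal_lagrangian (h : LDPConditions μ) (x β : E d) :
    (lagrangian μ x β).toENNReal = ENNReal.ofReal (lagrangianR μ x β) := by
  rw [← h.coe_lagrangianR, EReal.toENNReal_of_ne_top (EReal.coe_ne_top _)]
  simp

lemma LDPConditions.inner_sub_hamiltonianR_le (h : LDPConditions μ) (x α β : E d) :
    ⟪α, β⟫_ℝ - hamiltonianR μ x α ≤ lagrangianR μ x β := by
  have : ((⟪α, β⟫_ℝ : ℝ) : EReal) - hamiltonian μ x α ≤ lagrangian μ x β :=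
    le_iSup (fun α : E d => ((⟪α, β⟫_ℝ : ℝ) : EReal) - hamiltonian μ x α) α
  rw [← h.coe_hamiltonianR, ← h.coe_lagrangianR] at this
  exact_mod_cast this

lemma LDPConditions.lagrangianR_le (h : LDPConditions μ) {x β : E d} {c : ℝ}
    (hc : ∀ α, ⟪α, β⟫_ℝ - hamiltonianR μ x α ≤ c) : lagrangianR μ x β ≤ c := by
  have : lagrangian μ x β ≤ (c : EReal) := by
    refine iSup_le fun α => ?_
    rw [← h.coe_hamiltonianR]
    exact_mod_cast hc α
  rw [← h.coe_lagrangianR] at this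
  exact_mod_cast this

/-- The logarithmic moment generating function is convex, by Hölder's inequality. -/
lemma LDPConditions.convexOn_hamiltonianR (h : LDPConditions μ) (x : E d) :
    ConvexOn ℝ univ (hamiltonianR μ x) := by
  refine ⟨convex_univ, fun α _ α' _ a b ha hb hab => ?_⟩
  have key : ∫⁻ z, ENNReal.ofReal (Real.exp ⟪a • α + b • α', z⟫_ℝ) ∂(μ x) ≤
      (∫⁻ z, ENNReal.ofReal (Real.exp ⟪α, z⟫_ℝ) ∂(μ x)) ^ a *
      (∫⁻ z, ENNReal.ofReal (Real.exp ⟪α', z⟫_ℝ) ∂(μ x)) ^ b := by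
    refine le_trans (le_of_eq ?_) (ENNReal.lintegral_mul_norm_pow_le (by fun_prop) (by fun_prop)
      ha hb hab)
    refine lintegral_congr fun z => ?_
    rw [ENNReal.ofReal_rpow_of_pos (Real.exp_pos _), ENNReal.ofReal_rpow_of_pos (Real.exp_pos _),
      ← ENNReal.ofReal_mul (by positivity), ← Real.exp_mul, ← Real.exp_mul, ← Real.exp_add,
      inner_add_left, real_inner_smul_left, real_inner_smul_left]
    ring_nf
  have key' := ENNReal.log_le_log key
  rw [ENNReal.log_mul_add, ENNReal.log_rpow, ENNReal.log_rpow] at key'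
  change hamiltonian μ x _ ≤ a * hamiltonian μ x α + b * hamiltonian μ x α' at key'
  rw [← h.coe_hamiltonianR, ← h.coe_hamiltonianR, ← h.coe_hamiltonianR] at key'
  exact_mod_cast key'

/-- If the velocity `β` maximizes `⟪p, ·⟫ - L(x, ·)`, then `β` is the gradient of `H(x, ·)` at `p`:
by convexity the maximum is `H(x, p)`, so that `⟪·, β⟫ - L(x, β)` supports `H(x, ·)` at `p`. -/
lemma LDPConditions.gradient_hamiltonianR_eq (h : LDPConditions μ) {x p β : E d}
    (hd : DifferentiableAt ℝ (hamiltonianR μ x) p)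
    (hmax : ∀ β', ⟪p, β'⟫_ℝ - lagrangianR μ x β' ≤ ⟪p, β⟫_ℝ - lagrangianR μ x β) :
    gradient (hamiltonianR μ x) p = β := by
  -- The gradient `β₀` attains `H(x, p)` by convexity, hence so does the maximizer `β`.
  set β₀ := gradient (hamiltonianR μ x) p with hβ₀
  have h0 : lagrangianR μ x β₀ ≤ ⟪p, β₀⟫_ℝ - hamiltonianR μ x p := by
    refine h.lagrangianR_le fun α => ?_
    have := (h.convexOn_hamiltonianR x).inner_gradient_le hd α
    rw [← hβ₀, inner_sub_right, real_inner_comm, real_inner_comm p β₀] at this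
    linarith
  have h1 : hamiltonianR μ x p ≤ ⟪p, β⟫_ℝ - lagrangianR μ x β := by
    have := hmax β₀
    linarith
  have hgrad : HasGradientAt (fun q => hamiltonianR μ x q - ⟪q, β⟫_ℝ) (β₀ - β) p := by
    have e1 : HasGradientAt (hamiltonianR μ x) β₀ p := hd.hasGradientAt
    rw [hasGradientAt_iff_hasFDerivAt] at e1 ⊢
    have e2 : HasFDerivAt (fun q : E d => ⟪q, β⟫_ℝ) (InnerProductSpace.toDual ℝ (E d) β) p := by
      have := (InnerProductSpace.toDual ℝ (E d) β).hasFDerivAt (x := p)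
      refine this.congr_of_eventuallyEq (Eventually.of_forall fun q => ?_)
      simp [real_inner_comm]
    rw [map_sub]
    exact e1.sub e2
  have hmin : IsLocalMin (fun q => hamiltonianR μ x q - ⟪q, β⟫_ℝ) p := by
    refine Eventually.of_forall fun q => ?_
    have := h.inner_sub_hamiltonianR_le x q β
    show hamiltonianR μ x p - ⟪p, β⟫_ℝ ≤ hamiltonianR μ x q - ⟪q, β⟫_ℝ
    linarith
  have := hmin.hasFDerivAt_eq_zero hgrad.hasFDerivAt
  exact sub_eq_zero.1 ((InnerProductSpace.toDual ℝ (E d)).map_eq_zero_iff.1 this)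

/-- `L` is lower semicontinuous in both variables, as a supremum of continuous functions. -/
lemma LDPConditions.measurable_lagrangian (h : LDPConditions μ)
    (hH : ContDiff ℝ 2 fun p : E d × E d => hamiltonianR μ p.1 p.2) :
    Measurable fun p : E d × E d => lagrangian μ p.1 p.2 := by
  have : LowerSemicontinuous fun p : E d × E d => lagrangian μ p.1 p.2 := by
    refine lowerSemicontinuous_iSup fun α => Continuous.lowerSemicontinuous ?_
    have hc : Continuous fun p : E d × E d => hamiltonianR μ p.1 α :=
      hH.continuous.comp (continuous_fst.prodMk continuous_const)
    have : Continuous fun p : E d × E d => ((⟪α, p.2⟫_ℝ - hamiltonianR μ p.1 α : ℝ) : EReal) :=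
      continuous_coe_real_ereal.comp ((continuous_const.inner continuous_snd).sub hc)
    refine this.congr fun p => ?_
    rw [← h.coe_hamiltonianR]
    exact EReal.coe_sub _ _
  exact this.measurable

lemma LDPConditions.measurable_lagrangianR (h : LDPConditions μ)
    (hH : ContDiff ℝ 2 fun p : E d × E d => hamiltonianR μ p.1 p.2) :
    Measurable fun p : E d × E d => lagrangianR μ p.1 p.2 :=
  measurable_ereal_toReal.comp (h.measurable_lagrangian hH)

/-- `L` is upper semicontinuous in the space variable. -/
lemma LDPConditions.eventually_lagrangianR_le (h : LDPConditions μ) (x β : E d) {η : ℝ}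
    (hη : 0 < η) : ∃ δ > 0, ∀ y, ‖y - x‖ < δ → lagrangianR μ y β ≤ lagrangianR μ x β + η := by
  have hL := lagrangianR_nonneg (μ := μ) x β
  have hpos : 0 < 1 + lagrangianR μ x β := by linarith
  have hlt : (0 : EReal) < ((η / (1 + lagrangianR μ x β) : ℝ) : EReal) := by
    exact_mod_cast div_pos hη hpos
  have := (h.modulus_tendsto.eventually (gt_mem_nhds hlt)).and self_mem_nhdsWithin
  obtain ⟨δ, hδ, hδ0⟩ := this.exists
  refine ⟨δ, hδ0, fun y hy => ?_⟩
  have hle : (((lagrangianR μ y β - lagrangianR μ x β) / (1 + lagrangianR μ x β) : ℝ) : EReal) ≤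
      lagrangianModulus μ δ :=
    le_iSup_of_le y (le_iSup_of_le x (le_iSup_of_le hy (le_iSup_of_le β le_rfl)))
  have := lt_of_le_of_lt hle hδ
  have : (lagrangianR μ y β - lagrangianR μ x β) / (1 + lagrangianR μ x β) <
      η / (1 + lagrangianR μ x β) := by exact_mod_cast this
  rw [div_lt_div_iff_of_pos_right hpos] at this
  linarith

end Legendre

/-! ### Concatenation of absolutely continuous paths -/

section AbsolutelyContinuous

variable {F : Type*} [NormedAddCommGroup F]

lemma _root_.AbsolutelyContinuousOnInterval.congr {f g : ℝ → F} {a b : ℝ}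
    (hf : AbsolutelyContinuousOnInterval f a b) (h : EqOn f g (uIcc a b)) :
    AbsolutelyContinuousOnInterval g a b := by
  rw [absolutelyContinuousOnInterval_iff] at hf ⊢
  intro η hη
  obtain ⟨δ, hδ, H⟩ := hf η hη
  refine ⟨δ, hδ, fun I hI hlt => lt_of_le_of_lt (le_of_eq ?_) (H I hI hlt)⟩
  refine Finset.sum_congr rfl fun i hi => ?_
  rw [h (hI.1 i hi).1, h (hI.1 i hi).2]

/-- Precomposition with the retraction of `ℝ` onto `[c, e]` extends an absolutely continuous
function on `[c, e]` to any interval. -/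
lemma _root_.AbsolutelyContinuousOnInterval.comp_clamp {f : ℝ → F} {c e : ℝ} (hce : c ≤ e)
    (hf : AbsolutelyContinuousOnInterval f c e) (a b : ℝ) :
    AbsolutelyContinuousOnInterval (fun s => f (max c (min e s))) a b := by
  rw [absolutelyContinuousOnInterval_iff] at hf ⊢
  intro η hη
  obtain ⟨δ, hδ, H⟩ := hf η hη
  refine ⟨δ, hδ, fun I hI hlt => ?_⟩
  refine H (I.1, fun i => (max c (min e (I.2 i).1), max c (min e (I.2 i).2))) ⟨?_, ?_⟩ ?_
  · intro i _
    simp only [uIcc_of_le hce, mem_Icc]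
    grind
  · intro i hi j hj hij
    have := hI.2 hi hj hij
    simp only [Function.onFun, Set.disjoint_left, mem_uIoc] at this ⊢
    intro y hy hy'
    exact this (a := y) (by grind) (by grind)
  · refine lt_of_le_of_lt (Finset.sum_le_sum fun i _ => ?_) hlt
    simp only [Real.dist_eq]
    grind

/-- Two absolutely continuous paths which meet form an absolutely continuous path. -/
lemma _root_.AbsolutelyContinuousOnInterval.concat {f g : ℝ → F} {a t b : ℝ} (hat : a ≤ t)
    (htb : t ≤ b) (hf : AbsolutelyContinuousOnInterval f a t)
    (hg : AbsolutelyContinuousOnInterval g t b) (hfg : f t = g t) :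
    AbsolutelyContinuousOnInterval (fun s => if s ≤ t then f s else g s) a b := by
  have hc : AbsolutelyContinuousOnInterval (fun _ : ℝ => g t) a b :=
    (LipschitzWith.const (g t)).lipschitzOnWith.absolutelyContinuousOnInterval
  -- On `[a, b]` the path is `f (min s t) + g (max s t) - g t`.
  refine (((hf.comp_clamp hat a b).add (hg.comp_clamp htb a b)).sub hc).congr fun s hs => ?_
  rw [uIcc_of_le (hat.trans htb), mem_Icc] at hs
  simp only [Pi.add_apply, Pi.sub_apply]
  split_ifs with hst
  · rw [min_eq_right hst, max_eq_right hs.1, min_eq_right hs.2, max_eq_left hst, add_sub_cancel_right]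
  · have hst := le_of_not_ge hst
    rw [min_eq_left hst, max_eq_right hat, min_eq_right hs.2, max_eq_right hst, hfg, add_sub_cancel_left]

end AbsolutelyContinuous

/-! ### Dynamic programming along an optimal path -/

section DynamicProgramming

variable {d : ℕ} {μ : Kernel (E d) (E d)}

lemma quasiPotential_le_action {x₀ x : E d} {t : ℝ} {ψ : ℝ → E d} (h0 : ψ 0 = x₀) (ht : ψ t = x) :
    quasiPotential μ x₀ x t ≤ action μ t ψ := by
  unfold quasiPotential
  exact iInf_le_of_le ψ (iInf₂_le_of_le h0 ht le_rfl)

/-- The action of a concatenation is at most the sum of the actions. -/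
lemma quasiPotential_le_action_add {t b : ℝ} (ht : 0 ≤ t) (htb : t ≤ b) (ψ γ : ℝ → E d)
    (hγ : AbsolutelyContinuousOnInterval γ t b) (hψγ : ψ t = γ t) :
    quasiPotential μ (ψ 0) (γ b) b ≤
      action μ t ψ + ∫⁻ s in Icc t b, (lagrangian μ (γ s) (deriv γ s)).toENNReal := by
  by_cases hψ : AbsolutelyContinuousOnInterval ψ 0 t
  swap
  · simp [action, hψ]
  set χ : ℝ → E d := fun s => if s ≤ t then ψ s else γ s with hχdef
  have hχ : AbsolutelyContinuousOnInterval χ 0 b := hψ.concat ht htb hγ hψγ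
  have hχ0 : χ 0 = ψ 0 := by simp [hχdef, ht]
  have hχb : χ b = γ b := by
    by_cases hbt : b ≤ t
    · have : b = t := le_antisymm hbt htb
      simp [hχdef, this, hψγ]
    · simp [hχdef, hbt]
  refine (quasiPotential_le_action hχ0 hχb).trans ?_
  rw [action, action, if_pos hχ, if_pos hψ, ← Icc_union_Icc_eq_Icc ht htb]
  refine (lintegral_union_le _ _ _).trans (add_le_add (le_of_eq ?_) (le_of_eq ?_))
  · rw [← setLIntegral_congr Ioo_ae_eq_Icc, ← setLIntegral_congr Ioo_ae_eq_Icc]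
    refine setLIntegral_congr_fun measurableSet_Ioo fun s hs => ?_
    have h1 : χ =ᶠ[𝓝 s] ψ := by
      filter_upwards [Iio_mem_nhds hs.2] with u hu
      simp [hχdef, le_of_lt (mem_Iio.1 hu)]
    simp only [h1.eq_of_nhds, h1.deriv_eq]
  · rw [← setLIntegral_congr Ioo_ae_eq_Icc, ← setLIntegral_congr Ioo_ae_eq_Icc]
    refine setLIntegral_congr_fun measurableSet_Ioo fun s hs => ?_
    have h1 : χ =ᶠ[𝓝 s] γ := by
      filter_upwards [Ioi_mem_nhds hs.1] with u hu
      simp [hχdef, not_le.2 (mem_Ioi.1 hu)]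
    simp only [h1.eq_of_nhds, h1.deriv_eq]

lemma IsNOP.absolutelyContinuousOnInterval {T : ℝ} {x₀ xT : E d} {φ : ℝ → E d}
    (hφ : IsNOP μ T x₀ xT φ) : AbsolutelyContinuousOnInterval φ 0 T := by
  by_contra h
  have := hφ.finite
  simp [action, h] at this

lemma IsNOP.absolutelyContinuousOnInterval_of_le {T : ℝ} {x₀ xT : E d} {φ : ℝ → E d}
    (hφ : IsNOP μ T x₀ xT φ) {s t : ℝ} (hs : 0 ≤ s) (hst : s ≤ t) (htT : t ≤ T) :
    AbsolutelyContinuousOnInterval φ s t := by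
  refine hφ.absolutelyContinuousOnInterval.mono ?_
  rw [uIcc_of_le hst, uIcc_of_le ((hs.trans hst).trans htT)]
  exact Icc_subset_Icc hs htT

lemma IsNOP.lintegral_lt_top {T : ℝ} {x₀ xT : E d} {φ : ℝ → E d}
    (hφ : IsNOP μ T x₀ xT φ) :
    ∫⁻ s in Icc 0 T, (lagrangian μ (φ s) (deriv φ s)).toENNReal < ⊤ := by
  have := hφ.finite
  rwa [action, if_pos hφ.absolutelyContinuousOnInterval] at this

/-- Initial pieces of an optimal path are optimal. -/
lemma IsNOP.quasiPotential_eq {T : ℝ} {x₀ xT : E d} {φ : ℝ → E d}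
    (hφ : IsNOP μ T x₀ xT φ) {s : ℝ} (hs : s ∈ Icc 0 T) :
    quasiPotential μ x₀ (φ s) s =
      ∫⁻ r in Icc 0 s, (lagrangian μ (φ r) (deriv φ r)).toENNReal := by
  have hAC := hφ.absolutelyContinuousOnInterval_of_le le_rfl hs.1 hs.2
  have hAC' := hφ.absolutelyContinuousOnInterval_of_le hs.1 hs.2 le_rfl
  refine le_antisymm ?_ ?_
  · refine (quasiPotential_le_action hφ.start rfl).trans ?_
    rw [action, if_pos hAC]
  · refine le_iInf fun ψ => le_iInf fun h0 => le_iInf fun h1 => ?_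
    have h2 := quasiPotential_le_action_add (μ := μ) hs.1 hs.2 ψ φ hAC' h1
    rw [h0, hφ.finish, ← hφ.minimal, action, if_pos hφ.absolutelyContinuousOnInterval,
      ← Icc_union_Ioc_eq_Icc hs.1 hs.2, lintegral_union measurableSet_Ioc] at h2
    swap
    · exact Set.disjoint_left.2 fun r hr hr' => not_le.2 hr'.1 hr.2
    rw [← setLIntegral_congr (Ioc_ae_eq_Icc (a := s))] at h2
    refine (ENNReal.add_le_add_iff_right ?_).1 h2
    refine ne_top_of_le_ne_top hφ.lintegral_lt_top.ne (lintegral_mono_set ?_)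
    exact fun r hr => ⟨hs.1.trans hr.1.le, hr.2⟩

lemma IsNOP.quasiPotential_lt_top {T : ℝ} {x₀ xT : E d} {φ : ℝ → E d}
    (hφ : IsNOP μ T x₀ xT φ) {s : ℝ} (hs : s ∈ Icc 0 T) :
    quasiPotential μ x₀ (φ s) s < ⊤ := by
  rw [hφ.quasiPotential_eq hs]
  exact lt_of_le_of_lt (lintegral_mono_set (Icc_subset_Icc le_rfl hs.2)) hφ.lintegral_lt_top

variable [IsMarkovKernel μ]

lemma IsNOP.integrableOn_lagrangianR {T : ℝ} {x₀ xT : E d} {φ : ℝ → E d}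
    (hφ : IsNOP μ T x₀ xT φ) (h : LDPConditions μ) (hT : 0 ≤ T)
    (hH : ContDiff ℝ 2 fun p : E d × E d => hamiltonianR μ p.1 p.2) :
    IntegrableOn (fun r => lagrangianR μ (φ r) (deriv φ r)) (Icc 0 T) := by
  have hc : ContinuousOn φ (Icc 0 T) := by
    have := hφ.absolutelyContinuousOnInterval.continuousOn
    rwa [uIcc_of_le hT] at this
  have hm : AEMeasurable (fun r => lagrangianR μ (φ r) (deriv φ r))
      (volume.restrict (Icc 0 T)) := by
    have h1 : AEMeasurable (fun r => (φ r, deriv φ r)) (volume.restrict (Icc 0 T)) :=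
      (hc.aemeasurable measurableSet_Icc).prodMk (measurable_deriv φ).aemeasurable
    have h2 := h.measurable_lagrangianR hH
    have h3 := h2.comp_aemeasurable h1
    exact h3
  refine ⟨hm.aestronglyMeasurable, ?_⟩
  rw [hasFiniteIntegral_iff_ofReal (Eventually.of_forall fun r => lagrangianR_nonneg _ _)]
  simpa only [h.toENNReal_lagrangian] using hφ.lintegral_lt_top

lemma IsNOP.quasiPotentialR_eq_integral {T : ℝ} {x₀ xT : E d} {φ : ℝ → E d}
    (hφ : IsNOP μ T x₀ xT φ) (h : LDPConditions μ)
    (hH : ContDiff ℝ 2 fun p : E d × E d => hamiltonianR μ p.1 p.2) {s : ℝ} (hs : s ∈ Icc 0 T) :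
    quasiPotentialR μ x₀ (φ s) s = ∫ r in (0 : ℝ)..s, lagrangianR μ (φ r) (deriv φ r) := by
  have hint := (hφ.integrableOn_lagrangianR h (hs.1.trans hs.2) hH).mono_set
    (Icc_subset_Icc le_rfl hs.2)
  rw [quasiPotentialR, hφ.quasiPotential_eq hs, intervalIntegral.integral_of_le hs.1,
    ← integral_Icc_eq_integral_Ioc, integral_eq_lintegral_of_nonneg_ae
      (Eventually.of_forall fun r => lagrangianR_nonneg _ _) hint.1]
  simp only [h.toENNReal_lagrangian]

/-- The Hamilton–Jacobi inequality: continuing the optimal path from `φ s` with constant velocity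
`β` shows that `∂_t S + ⟪∇_x S, β⟫ ≤ L(φ s, β)`. -/
lemma IsNOP.fderiv_quasiPotentialR_le {T : ℝ} {x₀ xT : E d} {φ : ℝ → E d}
    (hφ : IsNOP μ T x₀ xT φ) (h : LDPConditions μ) {s : ℝ} (hs : s ∈ Icc 0 T)
    {D : E d × ℝ →L[ℝ] ℝ}
    (hD : HasFDerivAt (fun p : E d × ℝ => quasiPotentialR μ x₀ p.1 p.2) D (φ s, s)) (β : E d) :
    D (β, 1) ≤ lagrangianR μ (φ s) β := by
  refine le_of_forall_pos_le_add fun η hη => ?_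
  obtain ⟨δ, hδ, hL⟩ := h.eventually_lagrangianR_le (φ s) β hη
  set c := lagrangianR μ (φ s) β + η with hc
  have hc0 : 0 ≤ c := add_nonneg (lagrangianR_nonneg _ _) hη.le
  have hder : HasDerivAt (fun u : ℝ => quasiPotentialR μ x₀ (φ s + u • β) (s + u)) (D (β, 1)) 0 := by
    have e : HasDerivAt (fun u : ℝ => (φ s + u • β, s + u)) (β, (1 : ℝ)) 0 := by
      refine HasDerivAt.prodMk ?_ ?_
      · simpa using ((hasDerivAt_id (0 : ℝ)).smul_const β).const_add (φ s)
      · simpa using (hasDerivAt_id (0 : ℝ)).const_add s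
    have hD' : HasFDerivAt (fun p : E d × ℝ => quasiPotentialR μ x₀ p.1 p.2) D
        (φ s + (0 : ℝ) • β, s + 0) := by simpa using hD
    exact hD'.comp_hasDerivAt 0 e
  have hslope := (hasDerivWithinAt_iff_tendsto_slope' (s := Ioi (0 : ℝ)) (by simp)).1
    (hder.hasDerivWithinAt (s := Ioi 0))
  refine le_of_tendsto hslope ?_
  have hsmall : ∀ᶠ u : ℝ in 𝓝[>] 0, u * ‖β‖ < δ := by
    have : Tendsto (fun u : ℝ => u * ‖β‖) (𝓝[>] 0) (𝓝 0) := by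
      have : Tendsto (fun u : ℝ => u * ‖β‖) (𝓝 0) (𝓝 (0 * ‖β‖)) :=
        (continuous_id.mul continuous_const).tendsto 0
      rw [zero_mul] at this
      exact this.mono_left nhdsWithin_le_nhds
    exact this.eventually (gt_mem_nhds hδ)
  filter_upwards [hsmall, self_mem_nhdsWithin] with u hu hu0
  have hu0 : 0 < u := hu0
  set γ : ℝ → E d := fun r => φ s + (r - s) • β with hγ
  have hγd : ∀ r, HasDerivAt γ β r := fun r => by
    simpa only [hγ, id_eq, one_smul] using
      (((hasDerivAt_id r).sub_const s).smul_const β).const_add (φ s)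
  have hγAC : AbsolutelyContinuousOnInterval γ s (s + u) := by
    refine ContDiffOn.absolutelyContinuousOnInterval (ContDiff.contDiffOn ?_)
    exact contDiff_const.add ((contDiff_id.sub contDiff_const).smul contDiff_const)
  have hact := quasiPotential_le_action_add (μ := μ) hs.1 (le_add_of_nonneg_right hu0.le) φ γ hγAC
    (by simp [hγ])
  have hγu : γ (s + u) = φ s + u • β := by simp [hγ]
  have hcost : ∫⁻ r in Icc s (s + u), (lagrangian μ (γ r) (deriv γ r)).toENNReal ≤
      ENNReal.ofReal (c * u) := by
    have : ∀ r ∈ Icc s (s + u), (lagrangian μ (γ r) (deriv γ r)).toENNReal ≤ ENNReal.ofReal c := by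
      intro r hr
      rw [h.toENNReal_lagrangian, (hγd r).deriv]
      refine ENNReal.ofReal_le_ofReal (hL _ ?_)
      have h1 : 0 ≤ r - s := by linarith [hr.1]
      have h2 : r - s ≤ u := by linarith [hr.2]
      simp only [hγ, add_sub_cancel_left, norm_smul, Real.norm_eq_abs, abs_of_nonneg h1]
      exact lt_of_le_of_lt (mul_le_mul_of_nonneg_right h2 (norm_nonneg _)) hu
    refine (setLIntegral_mono' measurableSet_Icc this).trans (le_of_eq ?_)
    rw [setLIntegral_const, Real.volume_Icc, add_sub_cancel_left, ENNReal.ofReal_mul hc0]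
  rw [hγu, hφ.start, action,
    if_pos (hφ.absolutelyContinuousOnInterval_of_le le_rfl hs.1 hs.2), ← hφ.quasiPotential_eq hs]
    at hact
  have hfin := (hφ.quasiPotential_lt_top hs).ne
  have hreal : quasiPotentialR μ x₀ (φ s + u • β) (s + u) ≤ quasiPotentialR μ x₀ (φ s) s + c * u := by
    have := ENNReal.toReal_mono (by finiteness) (hact.trans (add_le_add le_rfl hcost))
    rwa [ENNReal.toReal_add hfin ENNReal.ofReal_ne_top, ENNReal.toReal_ofReal (by positivity)] at this
  rw [slope_def_field]
  simp only [zero_smul, add_zero, sub_zero]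
  rw [div_le_iff₀ hu0]
  linarith

/-- An optimal path follows the characteristics: `φ' = ∇_α H(φ, ∇_x S(φ, s | x₀))` at almost every
time at which `S` is differentiable at `(φ s, s)`. Along `φ` the Hamilton–Jacobi inequality is an
equality, so that the velocity maximizes `⟪∇_x S, ·⟫ - L(φ s, ·)`. -/
lemma IsNOP.ae_hasDerivAt {T : ℝ} {x₀ xT : E d} {φ : ℝ → E d}
    (hφ : IsNOP μ T x₀ xT φ) (h : LDPConditions μ) (hT : 0 ≤ T)
    (hH : ContDiff ℝ 2 fun p : E d × E d => hamiltonianR μ p.1 p.2) :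
    ∀ᵐ s, s ∈ Ioo 0 T →
      DifferentiableAt ℝ (fun p : E d × ℝ => quasiPotentialR μ x₀ p.1 p.2) (φ s, s) →
      HasDerivAt φ (gradient (hamiltonianR μ (φ s))
        (gradient (fun y => quasiPotentialR μ x₀ y s) (φ s))) s := by
  have hint : IntervalIntegrable (fun r => lagrangianR μ (φ r) (deriv φ r)) volume 0 T := by
    rw [intervalIntegrable_iff_integrableOn_Icc_of_le hT]
    exact hφ.integrableOn_lagrangianR h hT hH
  have hdiff : ∀ᵐ s, s ∈ uIcc 0 T → DifferentiableAt ℝ φ s :=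
    hφ.absolutelyContinuousOnInterval.boundedVariationOn.ae_differentiableAt_of_mem_uIcc
  filter_upwards [hint.ae_hasDerivAt_integral, hdiff] with s hs1 hs2 hs hd
  have hsI : s ∈ Icc 0 T := Ioo_subset_Icc_self hs
  have hsu : s ∈ uIcc 0 T := by rwa [uIcc_of_le hT]
  have hφd := (hs2 hsu).hasDerivAt
  obtain ⟨D, hD⟩ := hd
  have e1 : HasDerivAt (fun r => quasiPotentialR μ x₀ (φ r) r) (lagrangianR μ (φ s) (deriv φ s)) s := by
    refine (hs1 hsu 0 (by simp)).congr_of_eventuallyEq ?_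
    filter_upwards [Icc_mem_nhds hs.1 hs.2] with r hr
    exact hφ.quasiPotentialR_eq_integral h hH hr
  have e2 : HasDerivAt (fun r => quasiPotentialR μ x₀ (φ r) r) (D (deriv φ s, 1)) s :=
    HasFDerivAt.comp_hasDerivAt (f := fun r => (φ r, r)) s hD (hφd.prodMk (hasDerivAt_id s))
  have heq := e1.unique e2
  set p := gradient (fun y => quasiPotentialR μ x₀ y s) (φ s) with hp
  have hpi : ∀ v, ⟪p, v⟫_ℝ = D (v, 0) := by
    intro v
    have : HasFDerivAt (fun y => quasiPotentialR μ x₀ y s)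
        (D.comp (ContinuousLinearMap.inl ℝ (E d) ℝ)) (φ s) := by
      have e : HasFDerivAt (fun y : E d => (y, s)) (ContinuousLinearMap.inl ℝ (E d) ℝ) (φ s) :=
        hasFDerivAt_prodMk_left _ _
      exact hD.comp (φ s) e
    rw [hp, gradient, this.fderiv]
    simp
  have hsplit : ∀ v, D (v, 1) = ⟪p, v⟫_ℝ + D (0, 1) := by
    intro v
    rw [hpi, ← map_add]
    simp
  have := h.gradient_hamiltonianR_eq (p := p) (β := deriv φ s)
    (differentiable_hamiltonianR hH (φ s) p) (fun β' => by
      have h1 := hφ.fderiv_quasiPotentialR_le h hsI hD β'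
      rw [hsplit] at h1 heq
      linarith)
  rw [this]
  exact hφd

end DynamicProgramming

/-! ### Regularity of the limiting drift and the equation of the reversed path -/

section Drift

variable {d : ℕ} {μ : Kernel (E d) (E d)}

/-- The velocity `∇_α H(x, ∇_x S(x, s | x₀))` of the forward characteristics, so that
`b̄(x, t)` is its negative at `s = T - t`. -/
noncomputable def charVelocity (μ : Kernel (E d) (E d)) (x₀ : E d) (p : E d × ℝ) : E d :=
  gradient (hamiltonianR μ p.1) (gradient (fun y => quasiPotentialR μ x₀ y p.2) p.1)

lemma limitDrift_eq_neg_charVelocity (T : ℝ) (x₀ x : E d) (t : ℝ) :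
    limitDrift μ T x₀ x t = -charVelocity μ x₀ (x, T - t) := rfl

lemma isOpen_tube (φ : ℝ → E d) (δ t₁ t₂ : ℝ) : IsOpen (tube φ δ t₁ t₂) :=
  isOpen_biUnion fun _ _ => Metric.isOpen_ball

lemma ball_subset_tube (φ : ℝ → E d) (δ : ℝ) {t₁ t₂ t : ℝ} (ht : t ∈ Icc t₁ t₂) :
    Metric.ball (φ t) δ ⊆ tube φ δ t₁ t₂ :=
  subset_biUnion_of_mem (u := fun t => Metric.ball (φ t) δ) ht

lemma contDiff_gradient_hamiltonianR
    (hH : ContDiff ℝ 2 fun p : E d × E d => hamiltonianR μ p.1 p.2) :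
    ContDiff ℝ 1 fun p : E d × E d => gradient (hamiltonianR μ p.1) p.2 := by
  have h1 : ContDiff ℝ 1 fun p : E d × E d =>
      fderiv ℝ (fun p : E d × E d => hamiltonianR μ p.1 p.2) p :=
    hH.fderiv_right (by norm_num)
  have h2 : ContDiff ℝ 1 fun p : E d × E d =>
      (fderiv ℝ (fun p : E d × E d => hamiltonianR μ p.1 p.2) p).comp
        (ContinuousLinearMap.inr ℝ (E d) (E d)) :=
    h1.clm_comp contDiff_const
  have h4 : ContDiff ℝ 1 fun p : E d × E d => (InnerProductSpace.toDual ℝ (E d)).symm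
      ((fderiv ℝ (fun p : E d × E d => hamiltonianR μ p.1 p.2) p).comp
        (ContinuousLinearMap.inr ℝ (E d) (E d))) :=
    (InnerProductSpace.toDual ℝ (E d)).symm.contDiff.comp h2
  convert h4 using 2 with p
  have h3 : HasFDerivAt (hamiltonianR μ p.1)
      ((fderiv ℝ (fun p : E d × E d => hamiltonianR μ p.1 p.2) p).comp
        (ContinuousLinearMap.inr ℝ (E d) (E d))) p.2 := by
    have e : HasFDerivAt (fun α : E d => (p.1, α)) (ContinuousLinearMap.inr ℝ (E d) (E d)) p.2 :=
      hasFDerivAt_prodMk_right _ _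
    exact ((hH.differentiable (by norm_num)) p).hasFDerivAt.comp p.2 e
  simp only [gradient, h3.fderiv]

/-- The space gradient at a fixed time is a part of the derivative within `U × [a, b]`, also at the end
points of the time interval, since `U` is open. -/
lemma contDiffOn_gradient_fst {f : E d × ℝ → ℝ} {U : Set (E d)} (hU : IsOpen U) {a b : ℝ}
    (hab : a < b) (hf : ContDiffOn ℝ 2 f (U ×ˢ Icc a b)) :
    ContDiffOn ℝ 1 (fun p : E d × ℝ => gradient (fun y => f (y, p.2)) p.1) (U ×ˢ Icc a b) := by
  have hu : UniqueDiffOn ℝ (U ×ˢ Icc a b) := hU.uniqueDiffOn.prod (uniqueDiffOn_Icc hab)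
  have h1 : ContDiffOn ℝ 1 (fun p => fderivWithin ℝ f (U ×ˢ Icc a b) p) (U ×ˢ Icc a b) :=
    hf.fderivWithin hu (by norm_num)
  have h2 : ContDiffOn ℝ 1 (fun p => (fderivWithin ℝ f (U ×ˢ Icc a b) p).comp
      (ContinuousLinearMap.inl ℝ (E d) ℝ)) (U ×ˢ Icc a b) :=
    h1.clm_comp contDiffOn_const
  refine ((InnerProductSpace.toDual ℝ (E d)).symm.contDiff.comp_contDiffOn h2).congr ?_
  intro p hp
  have h3 : HasFDerivWithinAt (fun y => f (y, p.2))
      ((fderivWithin ℝ f (U ×ˢ Icc a b) p).comp (ContinuousLinearMap.inl ℝ (E d) ℝ)) U p.1 := by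
    have e : HasFDerivWithinAt (fun y : E d => (y, p.2)) (ContinuousLinearMap.inl ℝ (E d) ℝ) U p.1 :=
      (hasFDerivAt_prodMk_left _ _).hasFDerivWithinAt
    have hmaps : MapsTo (fun y : E d => (y, p.2)) U (U ×ˢ Icc a b) := fun y hy => ⟨hy, hp.2⟩
    exact ((hf.differentiableOn (by norm_num)) p hp).hasFDerivWithinAt.comp p.1 e hmaps
  have h4 := h3.hasFDerivAt (hU.mem_nhds hp.1)
  simp only [Function.comp_apply, gradient, h4.fderiv]

lemma contDiffOn_charVelocity {x₀ : E d} {U : Set (E d)} (hU : IsOpen U) {a b : ℝ} (hab : a < b)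
    (hH : ContDiff ℝ 2 fun p : E d × E d => hamiltonianR μ p.1 p.2)
    (hS : ContDiffOn ℝ 2 (fun p : E d × ℝ => quasiPotentialR μ x₀ p.1 p.2) (U ×ˢ Icc a b)) :
    ContDiffOn ℝ 1 (charVelocity μ x₀) (U ×ˢ Icc a b) :=
  (contDiff_gradient_hamiltonianR hH).comp_contDiffOn
    (contDiff_fst.contDiffOn.prodMk (contDiffOn_gradient_fst hU hab hS))

/-- A `C¹` function near the graph of a continuous curve is Lipschitz in space on balls of fixed
radius around the curve, with a constant which does not depend on time. -/
lemma exists_lipschitz_near_curve {g : E d × ℝ → E d} {U : Set (E d)} (hU : IsOpen U) {a b : ℝ}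
    (hab : a < b) (hg : ContDiffOn ℝ 1 g (U ×ˢ Icc a b)) {φ : ℝ → E d}
    (hφ : ContinuousOn φ (Icc a b)) {r : ℝ} (hr : 0 ≤ r)
    (hrU : ∀ s ∈ Icc a b, Metric.closedBall (φ s) r ⊆ U) :
    ∃ C : ℝ, 0 ≤ C ∧ ∀ s ∈ Icc a b, ∀ x ∈ Metric.closedBall (φ s) r,
      ‖g (x, s) - g (φ s, s)‖ ≤ C * ‖x - φ s‖ := by
  have hu : UniqueDiffOn ℝ (U ×ˢ Icc a b) := hU.uniqueDiffOn.prod (uniqueDiffOn_Icc hab)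
  set K : Set (E d × ℝ) :=
    (fun p : E d × ℝ => (φ p.2 + p.1, p.2)) '' (Metric.closedBall 0 r ×ˢ Icc a b) with hK
  have hKc : IsCompact K := by
    refine ((isCompact_closedBall (0 : E d) r).prod isCompact_Icc).image_of_continuousOn ?_
    exact ((hφ.comp continuousOn_snd fun p hp => hp.2).add continuousOn_fst).prodMk continuousOn_snd
  have hmem : ∀ s ∈ Icc a b, ∀ x ∈ Metric.closedBall (φ s) r, (x, s) ∈ K := by
    intro s hs x hx
    refine ⟨(x - φ s, s), ⟨?_, hs⟩, by simp⟩
    simpa [dist_eq_norm] using hx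
  have hKU : K ⊆ U ×ˢ Icc a b := by
    rintro _ ⟨⟨y, s⟩, ⟨hy, hs⟩, rfl⟩
    refine ⟨hrU s hs ?_, hs⟩
    simpa [dist_eq_norm] using hy
  obtain ⟨C, hC⟩ := hKc.exists_bound_of_continuousOn
    ((hg.continuousOn_fderivWithin hu le_rfl).mono hKU)
  refine ⟨max C 0, le_max_right _ _, fun s hs x hx => ?_⟩
  have hder : ∀ y ∈ Metric.closedBall (φ s) r, HasFDerivWithinAt (fun y => g (y, s))
      ((fderivWithin ℝ g (U ×ˢ Icc a b) (y, s)).comp (ContinuousLinearMap.inl ℝ (E d) ℝ))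
      (Metric.closedBall (φ s) r) y := by
    intro y hy
    have e : HasFDerivWithinAt (fun y : E d => (y, s)) (ContinuousLinearMap.inl ℝ (E d) ℝ)
        (Metric.closedBall (φ s) r) y := (hasFDerivAt_prodMk_left _ _).hasFDerivWithinAt
    have hmaps : MapsTo (fun y : E d => (y, s)) (Metric.closedBall (φ s) r) (U ×ˢ Icc a b) :=
      fun y hy => ⟨hrU s hs hy, hs⟩
    exact ((hg.differentiableOn (by norm_num)) (y, s)
      ⟨hrU s hs hy, hs⟩).hasFDerivWithinAt.comp y e hmaps
  have hbound : ∀ y ∈ Metric.closedBall (φ s) r,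
      ‖(fderivWithin ℝ g (U ×ˢ Icc a b) (y, s)).comp (ContinuousLinearMap.inl ℝ (E d) ℝ)‖ ≤
        max C 0 := by
    intro y hy
    have h1 : ‖ContinuousLinearMap.inl ℝ (E d) ℝ‖ ≤ 1 := ContinuousLinearMap.norm_inl_le_one _ _ _
    refine (ContinuousLinearMap.opNorm_comp_le _ _).trans ?_
    refine (mul_le_of_le_one_right (norm_nonneg _) h1).trans ?_
    exact (hC _ (hmem s hs y hy)).trans (le_max_left _ _)
  exact (convex_closedBall (φ s) r).norm_image_sub_le_of_norm_hasFDerivWithin_le hder hbound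
    (Metric.mem_closedBall_self hr) hx

variable [IsMarkovKernel μ]

/-- Near its end an optimal path is a `C¹` solution of the characteristic equation; here in the
form of a uniform first order expansion, backwards in time. -/
lemma IsNOP.exists_expansion {T : ℝ} {x₀ xT : E d} {φ : ℝ → E d}
    (hφ : IsNOP μ T x₀ xT φ) (h : LDPConditions μ)
    (hH : ContDiff ℝ 2 fun p : E d × E d => hamiltonianR μ p.1 p.2) {U : Set (E d)}
    (hU : IsOpen U) {a : ℝ} (ha : 0 ≤ a) (haT : a < T)
    (hS : ContDiffOn ℝ 2 (fun p : E d × ℝ => quasiPotentialR μ x₀ p.1 p.2) (U ×ˢ Icc a T))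
    (hφU : ∀ s ∈ Icc a T, φ s ∈ U) {η : ℝ} (hη : 0 < η) :
    ∃ h₀ > 0, ∀ s ∈ Icc a T, ∀ t ∈ Icc a T, s ≤ t → t - s < h₀ →
      ‖φ s - (φ t - (t - s) • charVelocity μ x₀ (φ t, t))‖ ≤ η * (t - s) := by
  have hφc : ContinuousOn φ (Icc a T) := by
    have := (hφ.absolutelyContinuousOnInterval_of_le ha haT.le le_rfl).continuousOn
    rwa [uIcc_of_le haT.le] at this
  have hvc : ContinuousOn (fun s => charVelocity μ x₀ (φ s, s)) (Icc a T) :=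
    (contDiffOn_charVelocity hU haT hH hS).continuousOn.comp (hφc.prodMk continuousOn_id)
      fun s hs => ⟨hφU s hs, hs⟩
  -- The velocity along the path, extended continuously to all times; `φ` minus its primitive is
  -- absolutely continuous with vanishing derivative almost everywhere, hence constant.
  set v : ℝ → E d := IccExtend haT.le ((Icc a T).domRestrict fun s => charVelocity μ x₀ (φ s, s))
    with hv
  have hvcont : Continuous v := hvc.domRestrict.Icc_extend'
  have hv_eq : ∀ s ∈ Icc a T, v s = charVelocity μ x₀ (φ s, s) := fun s hs => by
    rw [hv, IccExtend_of_mem _ _ hs]; rfl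
  have hVd : ∀ t, HasDerivAt (fun t => ∫ r in a..t, v r) (v t) t := fun t =>
    intervalIntegral.integral_hasDerivAt_right (hvcont.intervalIntegrable _ _)
      hvcont.stronglyMeasurable.stronglyMeasurableAtFilter hvcont.continuousAt
  have hVAC : AbsolutelyContinuousOnInterval (fun t => ∫ r in a..t, v r) a T := by
    refine ContDiffOn.absolutelyContinuousOnInterval (ContDiff.contDiffOn ?_)
    rw [contDiff_one_iff_deriv]
    refine ⟨fun t => (hVd t).differentiableAt, ?_⟩
    rwa [show deriv (fun t => ∫ r in a..t, v r) = v from funext fun t => (hVd t).deriv]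
  have hGAC := (hφ.absolutelyContinuousOnInterval_of_le ha haT.le le_rfl).sub hVAC
  obtain ⟨c, hc⟩ := hGAC.const_of_ae_hasDerivAt_zero (by
    have h1 : ∀ᵐ x : ℝ, x ≠ a := by simp [ae_iff, measure_singleton]
    have h2 : ∀ᵐ x : ℝ, x ≠ T := by simp [ae_iff, measure_singleton]
    filter_upwards [hφ.ae_hasDerivAt h (ha.trans haT.le) hH, h1, h2] with s hs hsa hsT hsI
    rw [uIcc_of_le haT.le] at hsI
    have hsa' : a < s := lt_of_le_of_ne hsI.1 (Ne.symm hsa)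
    have hsT' : s < T := lt_of_le_of_ne hsI.2 hsT
    have hd : DifferentiableAt ℝ (fun p : E d × ℝ => quasiPotentialR μ x₀ p.1 p.2) (φ s, s) :=
      (hS.differentiableOn (by norm_num) _ ⟨hφU s hsI, hsI⟩).differentiableAt
        (prod_mem_nhds (hU.mem_nhds (hφU s hsI)) (Icc_mem_nhds hsa' hsT'))
    have := (hs ⟨ha.trans_lt hsa', hsT'⟩ hd).sub (hVd s)
    rw [hv_eq s hsI] at this
    simpa [charVelocity] using this)
  have hφV : ∀ t ∈ Icc a T, φ t = c + ∫ r in a..t, v r := by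
    intro t ht
    have := hc t (by rwa [uIcc_of_le haT.le])
    rw [← this]
    simp
  have huc := isCompact_Icc.uniformContinuousOn_of_continuous (hvcont.continuousOn (s := Icc a T))
  rw [Metric.uniformContinuousOn_iff] at huc
  obtain ⟨h₀, hh₀, H⟩ := huc η hη
  refine ⟨h₀, hh₀, fun s hs t ht hst hlt => ?_⟩
  have e1 : φ s - (φ t - (t - s) • charVelocity μ x₀ (φ t, t)) = -∫ r in s..t, (v r - v t) := by
    rw [intervalIntegral.integral_sub (hvcont.intervalIntegrable _ _) intervalIntegrable_const,
      intervalIntegral.integral_const, ← hv_eq t ht, hφV s hs, hφV t ht,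
      ← intervalIntegral.integral_add_adjacent_intervals (hvcont.intervalIntegrable a s)
        (hvcont.intervalIntegrable s t)]
    abel
  rw [e1, norm_neg]
  have := intervalIntegral.norm_integral_le_of_norm_le_const (a := s) (b := t) (C := η)
    (f := fun r => v r - v t) (fun r hr => by
      rw [uIoc_of_le hst] at hr
      have hrI : r ∈ Icc a T := ⟨hs.1.trans hr.1.le, hr.2.trans ht.2⟩
      have hd : dist r t < h₀ := by
        rw [Real.dist_eq, abs_sub_comm, abs_of_nonneg (by linarith [hr.2])]
        linarith [hr.1]
      rw [← dist_eq_norm]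
      exact (H r hrI t ht hd).le)
  rwa [abs_of_nonneg (by linarith)] at this

end Drift

/-! ### A Lyapunov function of linear growth -/

section Lyapunov

variable {F : Type*} [NormedAddCommGroup F]

/-- The Lyapunov function `√(1 + |y|²) - 1`. It is quadratic near the origin and of linear growth,
so that its second order Taylor remainder is controlled by moments of any order in `(1, 2]`. -/
noncomputable def lyapunov (y : F) : ℝ := √(1 + ‖y‖ ^ 2) - 1

lemma one_le_sqrt_one_add_sq (r : ℝ) : 1 ≤ √(1 + r ^ 2) :=
  Real.one_le_sqrt.2 (by nlinarith [sq_nonneg r])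

lemma lyapunov_nonneg (y : F) : 0 ≤ lyapunov y :=
  sub_nonneg.2 (one_le_sqrt_one_add_sq _)

lemma continuous_lyapunov : Continuous (lyapunov : F → ℝ) := by
  unfold lyapunov
  fun_prop

/-- An affine bound on the displacement gives an affine bound on the Lyapunov function: by
concavity of the square root, dilation by `1 + c` costs at most the factor `(1 + c)²`. -/
lemma lyapunov_le_of_norm_le {y y' : F} {c e : ℝ} (hc : 0 ≤ c) (he : 0 ≤ e)
    (h : ‖y'‖ ≤ (1 + c) * ‖y‖ + e) : lyapunov y' ≤ (1 + c) ^ 2 * lyapunov y + e := by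
  unfold lyapunov
  set r := ‖y‖ with hr
  have hr0 : 0 ≤ r := norm_nonneg y
  set s := √(1 + r ^ 2) with hs
  have hs1 : 1 ≤ s := one_le_sqrt_one_add_sq r
  have hss : s ^ 2 = 1 + r ^ 2 := Real.sq_sqrt (by positivity)
  have hsr : r ≤ s := Real.le_sqrt_of_sq_le (by linarith)
  have hk : 1 ≤ (1 + c) ^ 2 := by nlinarith
  set k := (1 + c) ^ 2 with hkdef
  have hkr : ((1 + c) * r) ^ 2 = k * r ^ 2 := by rw [hkdef]; ring
  have h1 : (1 + c) * r ≤ 1 + k * (s - 1) := by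
    refine abs_le_of_sq_le_sq' ?_ (by nlinarith) |>.2
    rw [hkr]
    have : r ^ 2 = s ^ 2 - 1 := by linarith
    rw [this]
    nlinarith [mul_nonneg (sub_nonneg.2 hk) (sq_nonneg (s - 1)), mul_nonneg
      (mul_nonneg (sub_nonneg.2 hk) (by linarith : (0 : ℝ) ≤ k)) (sq_nonneg (s - 1))]
  have h2 : 1 + ((1 + c) * r) ^ 2 ≤ (1 + k * (s - 1)) ^ 2 := by
    rw [hkr]
    have : r ^ 2 = s ^ 2 - 1 := by linarith
    rw [this]
    nlinarith [mul_nonneg (mul_nonneg (sub_nonneg.2 hk) (by linarith : (0 : ℝ) ≤ k))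
      (sq_nonneg (s - 1))]
  have h0 : 0 ≤ k * (s - 1) := mul_nonneg (by linarith) (by linarith)
  have : √(1 + ‖y'‖ ^ 2) ≤ 1 + k * (s - 1) + e := by
    rw [Real.sqrt_le_left (by linarith)]
    have : ‖y'‖ ^ 2 ≤ ((1 + c) * r + e) ^ 2 := pow_le_pow_left₀ (norm_nonneg _) h 2
    nlinarith [mul_le_mul_of_nonneg_right h1 he]
  linarith

variable [InnerProductSpace ℝ F]

/-- First order expansion with a remainder of order `1 + κ`. The remainder is at most
`min (|h|² / 2) (2 |h|)`. -/
lemma lyapunov_add_le (y h : F) {κ : ℝ} (hκ : κ ∈ Ioc (0 : ℝ) 1) :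
    lyapunov (y + h) ≤ lyapunov y + ⟪(√(1 + ‖y‖ ^ 2))⁻¹ • y, h⟫_ℝ + 2 * ‖h‖ ^ (1 + κ) := by
  unfold lyapunov
  rw [real_inner_smul_left]
  set s := √(1 + ‖y‖ ^ 2) with hs
  have hs1 : 1 ≤ s := one_le_sqrt_one_add_sq _
  have hss : s ^ 2 = 1 + ‖y‖ ^ 2 := Real.sq_sqrt (by positivity)
  have hys : ‖y‖ ≤ s := Real.le_sqrt_of_sq_le (by linarith)
  have hs0 : 0 < s := by linarith
  have hin : -‖h‖ ≤ s⁻¹ * ⟪y, h⟫_ℝ := by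
    have h1 : |⟪y, h⟫_ℝ| ≤ s * ‖h‖ :=
      (abs_real_inner_le_norm y h).trans (mul_le_mul_of_nonneg_right hys (norm_nonneg _))
    have h2 := (abs_le.1 h1).1
    rw [inv_mul_eq_div, le_div_iff₀ hs0]
    linarith
  have hpow : ‖h‖ ≤ 1 → ‖h‖ ^ 2 ≤ ‖h‖ ^ (1 + κ) := by
    intro hle
    rcases (norm_nonneg h).eq_or_lt with h0 | h0
    · rw [← h0, Real.zero_rpow (by linarith [hκ.1])]
      norm_num
    · rw [← Real.rpow_natCast]
      exact Real.rpow_le_rpow_of_exponent_ge h0 hle (by push_cast; linarith [hκ.2])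
  rcases le_total ‖h‖ 1 with hle | hle
  · have hle' := hpow hle
    have : √(1 + ‖y + h‖ ^ 2) ≤ s + s⁻¹ * ⟪y, h⟫_ℝ + ‖h‖ ^ 2 := by
      rw [Real.sqrt_le_left (by nlinarith [norm_nonneg h]), norm_add_sq_real]
      set q := s⁻¹ * ⟪y, h⟫_ℝ with hq
      have hsq : ⟪y, h⟫_ℝ = s * q := by rw [hq]; field_simp
      rw [hsq]
      nlinarith [sq_nonneg (q + ‖h‖ ^ 2), mul_nonneg (sub_nonneg.2 hs1) (sq_nonneg ‖h‖),
        sq_nonneg ‖h‖]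
    have h3 : 0 ≤ ‖h‖ ^ (1 + κ) := Real.rpow_nonneg (norm_nonneg _) _
    linarith
  · have h3 : ‖h‖ ≤ ‖h‖ ^ (1 + κ) := by
      calc ‖h‖ = ‖h‖ ^ (1 : ℝ) := (Real.rpow_one _).symm
        _ ≤ _ := Real.rpow_le_rpow_of_exponent_le hle (by linarith [hκ.1])
    have h4 : √(1 + ‖y + h‖ ^ 2) ≤ s + ‖h‖ := by
      rw [Real.sqrt_le_left (by positivity)]
      have : ‖y + h‖ ^ 2 ≤ (‖y‖ + ‖h‖) ^ 2 := pow_le_pow_left₀ (norm_nonneg _) (norm_add_le _ _) 2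
      nlinarith [mul_le_mul_of_nonneg_right hys (norm_nonneg h)]
    linarith

variable [MeasurableSpace F] [BorelSpace F] [SecondCountableTopology F] [CompleteSpace F]

/-- Expected increase of the Lyapunov function under a jump `ε z` with a finite moment of order
`1 + κ`, compared with a jump to the mean. -/
lemma lintegral_lyapunov_add_smul_le {ν : Measure F} [IsProbabilityMeasure ν]
    (hint : Integrable (fun z : F => z) ν) {κ : ℝ} (hκ : κ ∈ Ioc (0 : ℝ) 1) {G : ℝ≥0}
    (hG : ∫⁻ z, ‖z - ∫ w, w ∂ν‖ₑ ^ (1 + κ) ∂ν ≤ G) {ε : ℝ} (hε : 0 ≤ ε) (y : F) :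
    ∫⁻ z, ENNReal.ofReal (lyapunov (y + ε • z)) ∂ν ≤
      ENNReal.ofReal (lyapunov (y + ε • ∫ w, w ∂ν) + 2 * ε ^ (1 + κ) * G) := by
  set b := ∫ w, w ∂ν with hb
  have hκ0 : 0 ≤ 1 + κ := by linarith [hκ.1]
  have henorm : ∀ z : F, ‖z - b‖ₑ ^ (1 + κ) = ENNReal.ofReal (‖z - b‖ ^ (1 + κ)) := fun z => by
    rw [← ofReal_norm, ENNReal.ofReal_rpow_of_nonneg (norm_nonneg _) hκ0]
  simp only [henorm] at hG
  have hmom : Integrable (fun z => ‖z - b‖ ^ (1 + κ)) ν := by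
    refine ⟨by fun_prop, ?_⟩
    rw [hasFiniteIntegral_iff_ofReal (Eventually.of_forall fun z => by positivity)]
    exact hG.trans_lt ENNReal.coe_lt_top
  have hmomG : ∫ z, ‖z - b‖ ^ (1 + κ) ∂ν ≤ G := by
    rw [integral_eq_lintegral_of_nonneg_ae (Eventually.of_forall fun z => by positivity) hmom.1]
    exact ENNReal.toReal_le_coe_of_le_coe hG
  set g : F := (√(1 + ‖y + ε • b‖ ^ 2))⁻¹ • (y + ε • b) with hg
  have hcen : Integrable (fun z => z - b) ν := hint.sub (integrable_const b)
  have hlin : Integrable (fun z => ⟪g, ε • (z - b)⟫_ℝ) ν := (hcen.smul ε).const_inner g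
  have hlin0 : ∫ z, ⟪g, ε • (z - b)⟫_ℝ ∂ν = 0 := by
    have h0 : ∫ z, (z - b) ∂ν = 0 := by
      rw [integral_sub hint (integrable_const b), integral_const]
      simp [hb]
    have hsm : Integrable (fun z => ε • (z - b)) ν := hcen.smul ε
    rw [integral_inner hsm, integral_smul, h0, smul_zero, inner_zero_right]
  have hpt : ∀ z, lyapunov (y + ε • z) ≤
      lyapunov (y + ε • b) + ⟪g, ε • (z - b)⟫_ℝ + 2 * ε ^ (1 + κ) * ‖z - b‖ ^ (1 + κ) := by
    intro z
    have := lyapunov_add_le (y + ε • b) (ε • (z - b)) hκ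
    have e : y + ε • b + ε • (z - b) = y + ε • z := by module
    rw [e, norm_smul, Real.norm_of_nonneg hε, Real.mul_rpow hε (norm_nonneg _)] at this
    linarith
  have hI1 : Integrable (fun z => lyapunov (y + ε • b) + ⟪g, ε • (z - b)⟫_ℝ) ν :=
    (integrable_const _).add hlin
  have hI2 : Integrable (fun z => 2 * ε ^ (1 + κ) * ‖z - b‖ ^ (1 + κ)) ν := hmom.const_mul _
  have hI3 : Integrable (fun z => lyapunov (y + ε • z)) ν := by
    have hm : Continuous fun z : F => lyapunov (y + ε • z) := continuous_lyapunov.comp (by fun_prop)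
    refine (hI1.add hI2).mono' hm.aestronglyMeasurable (Eventually.of_forall fun z => ?_)
    rw [Real.norm_of_nonneg (lyapunov_nonneg _)]
    exact hpt z
  rw [← ofReal_integral_eq_lintegral_ofReal hI3 (Eventually.of_forall fun z => lyapunov_nonneg _)]
  refine ENNReal.ofReal_le_ofReal ?_
  calc ∫ z, lyapunov (y + ε • z) ∂ν
      ≤ ∫ z, (lyapunov (y + ε • b) + ⟪g, ε • (z - b)⟫_ℝ +
          2 * ε ^ (1 + κ) * ‖z - b‖ ^ (1 + κ)) ∂ν := integral_mono hI3 (hI1.add hI2) hpt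
    _ = lyapunov (y + ε • b) + 2 * ε ^ (1 + κ) * ∫ z, ‖z - b‖ ^ (1 + κ) ∂ν := by
        rw [integral_add hI1 hI2, integral_add (integrable_const _) hlin, hlin0, integral_const,
          integral_const_mul]
        simp
    _ ≤ _ := by gcongr

end Lyapunov

/-! ### Exit estimate for the reversed chain -/

section Chain

variable {d : ℕ}

/-- Integration against the joint law of the present state and the next jump. -/
lemma setLIntegral_jump_eq {Ω : Type*} [MeasurableSpace Ω] {P : Measure Ω} [IsFiniteMeasure P]
    {Y Z : Ω → E d} (hY : Measurable Y) (hZ : Measurable Z) (κ : Kernel (E d) (E d))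
    [IsFiniteKernel κ] {A : Set Ω}
    (hA : ∀ B D : Set (E d), MeasurableSet B → MeasurableSet D →
      P (A ∩ Y ⁻¹' B ∩ Z ⁻¹' D) = ∫⁻ ω in A ∩ Y ⁻¹' B, κ (Y ω) D ∂P)
    {f : E d × E d → ℝ≥0∞} (hf : Measurable f) :
    ∫⁻ ω in A, f (Y ω, Z ω) ∂P = ∫⁻ ω in A, ∫⁻ z, f (Y ω, z) ∂(κ (Y ω)) ∂P := by
  have hlaw : (P.restrict A).map (fun ω => (Y ω, Z ω)) = (P.restrict A).map Y ⊗ₘ κ := by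
    refine Measure.ext_prod fun {B D} hB hD => ?_
    rw [Measure.compProd_apply_prod hB hD, Measure.map_apply (hY.prodMk hZ) (hB.prod hD),
      setLIntegral_map hB (κ.measurable_coe hD) hY,
      Measure.restrict_apply ((hY.prodMk hZ) (hB.prod hD)), Measure.restrict_restrict (hY hB),
      inter_comm (Y ⁻¹' B) A, ← hA B D hB hD]
    congr 1
    ext ω
    simp only [mem_inter_iff, mem_preimage, mem_prod]
    tauto
  rw [← lintegral_map hf (hY.prodMk hZ), hlaw, Measure.lintegral_compProd hf,
    lintegral_map hf.lintegral_kernel_prod_right' hY]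

open Classical in
/-- The reversed jump laws at `n + 2` remaining steps as a kernel, cut off outside a set `U` on which
they are probability measures. -/
noncomputable def reversedKernel {ρ : E d → E d → ℝ≥0∞} (hρ : Measurable (Function.uncurry ρ))
    (ε : ℝ) (x₀ : E d) (n : ℕ) {U : Set (E d)} (hU : MeasurableSet U) : Kernel (E d) (E d) where
  toFun x := if x ∈ U then reversedJumpLaw ρ ε x₀ (n + 2) x else 0
  measurable' := by
    refine Measurable.ite hU ?_ measurable_const
    refine Measure.measurable_of_measurable_coe _ fun D hD => ?_
    simp only [reversedJumpLaw, withDensity_apply _ hD]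
    have h1 : Measurable fun q : E d × E d => q.1 + ε • q.2 := by fun_prop
    have hm : Measurable fun q : E d × E d =>
        forwardDensity ρ ε x₀ (n + 1) (q.1 + ε • q.2) * ρ (q.1 + ε • q.2) (-q.2) /
          forwardDensity ρ ε x₀ (n + 2) q.1 :=
      (((measurable_forwardDensity hρ ε x₀ (n + 1)).comp h1).mul
        (hρ.comp (h1.prodMk measurable_snd.neg))).div
        ((measurable_forwardDensity hρ ε x₀ (n + 2)).comp measurable_fst)
    exact hm.lintegral_prod_right'

lemma reversedKernel_apply {ρ : E d → E d → ℝ≥0∞} (hρ : Measurable (Function.uncurry ρ))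
    (ε : ℝ) (x₀ : E d) (n : ℕ) {U : Set (E d)} (hU : MeasurableSet U) {x : E d} (hx : x ∈ U) :
    reversedKernel hρ ε x₀ n hU x = reversedJumpLaw ρ ε x₀ (n + 2) x :=
  if_pos hx

lemma isFiniteKernel_reversedKernel {ρ : E d → E d → ℝ≥0∞} (hρ : Measurable (Function.uncurry ρ))
    (ε : ℝ) (x₀ : E d) (n : ℕ) {U : Set (E d)} (hU : MeasurableSet U)
    (hprob : ∀ x ∈ U, reversedJumpLaw ρ ε x₀ (n + 2) x univ = 1) :
    IsFiniteKernel (reversedKernel hρ ε x₀ n hU) := by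
  refine ⟨1, ENNReal.one_lt_top, fun x => ?_⟩
  by_cases hx : x ∈ U
  · rw [reversedKernel_apply hρ ε x₀ n hU hx, hprob x hx]
  · simp [reversedKernel, hx]

/-- The event that the first values `X 0, …, X m` stay within distance `r` of `c 0, …, c m`. -/
def stayEvent {Ω : Type*} (X : ℕ → Ω → E d) (c : ℕ → E d) (r : ℝ) (m : ℕ) : Set Ω :=
  {ω | ∀ i ≤ m, ‖X i ω - c i‖ < r}

lemma measurableSet_stayEvent {Ω : Type*} (X : ℕ → Ω → E d) (c : ℕ → E d) (r : ℝ) (m : ℕ) :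
    MeasurableSet[⨆ (i : ℕ) (_ : i ≤ m), MeasurableSpace.comap (X i) inferInstance]
      (stayEvent X c r m) := by
  have : stayEvent X c r m = ⋂ (i : ℕ) (_ : i ≤ m), X i ⁻¹' Metric.ball (c i) r := by
    ext ω
    simp [stayEvent, dist_eq_norm]
  rw [this]
  refine MeasurableSet.iInter fun i => MeasurableSet.iInter fun hi => ?_
  have hle : MeasurableSpace.comap (X i) inferInstance ≤
      ⨆ (i : ℕ) (_ : i ≤ m), MeasurableSpace.comap (X i) inferInstance :=
    le_iSup₂_of_le i hi le_rfl
  exact hle _ ⟨_, Metric.isOpen_ball.measurableSet, rfl⟩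

lemma stayEvent_succ {Ω : Type*} (X : ℕ → Ω → E d) (c : ℕ → E d) (r : ℝ) (m : ℕ) :
    stayEvent X c r (m + 1) = stayEvent X c r m ∩ {ω | ‖X (m + 1) ω - c (m + 1)‖ < r} := by
  ext ω
  simp only [stayEvent, mem_inter_iff, mem_ofPred_eq]
  constructor
  · exact fun h => ⟨fun i hi => h i (by omega), h _ le_rfl⟩
  · rintro ⟨h1, h2⟩ i hi
    rcases Nat.lt_or_ge i (m + 1) with h | h
    · exact h1 i (by omega)
    · rwa [le_antisymm hi h]

/-- The expected value of the Lyapunov function of `X m - c m`, stopped at the exit from the tube and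
counted there with its smallest possible value `w`. -/
noncomputable def stoppedLyapunov {Ω : Type*} [MeasurableSpace Ω] (P : Measure Ω)
    (X : ℕ → Ω → E d) (c : ℕ → E d) (r w : ℝ) (m : ℕ) : ℝ≥0∞ :=
  ∫⁻ ω in stayEvent X c r m, ENNReal.ofReal (lyapunov (X m ω - c m)) ∂P +
    ENNReal.ofReal w * P (stayEvent X c r m)ᶜ

variable {Ω : Type*} [MeasurableSpace Ω] {P : Measure Ω} [IsProbabilityMeasure P]

/-- While the chain is in the tube, an estimate on the expected Lyapunov function after one jump
gives an estimate on the stopped process. -/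
lemma IsReversedChain.stoppedLyapunov_succ_le {ρ : E d → E d → ℝ≥0∞}
    (hρ : Measurable (Function.uncurry ρ)) {T ε : ℝ} (hε : ε ≠ 0) {x₀ xT : E d} {X : ℕ → Ω → E d}
    (hX : IsReversedChain P ρ T ε x₀ xT X) {c : ℕ → E d} {r w : ℝ}
    (hw : ∀ y : E d, r ≤ ‖y‖ → w ≤ lyapunov y) {m n : ℕ} (hn : ⌊T / ε⌋₊ - m = n + 2)
    (hprob : ∀ x ∈ Metric.ball (c m) r, reversedJumpLaw ρ ε x₀ (n + 2) x univ = 1)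
    {K e : ℝ≥0∞} (hK : 1 ≤ K)
    (hstep : ∀ x ∈ Metric.ball (c m) r,
      ∫⁻ z, ENNReal.ofReal (lyapunov (x + ε • z - c (m + 1))) ∂(reversedJumpLaw ρ ε x₀ (n + 2) x) ≤
        K * ENNReal.ofReal (lyapunov (x - c m)) + e) :
    stoppedLyapunov P X c r w (m + 1) ≤ K * stoppedLyapunov P X c r w m + e := by
  have hmX := hX.measurable
  have hσ : (⨆ (i : ℕ) (_ : i ≤ m), MeasurableSpace.comap (X i) inferInstance) ≤
      (inferInstance : MeasurableSpace Ω) :=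
    iSup₂_le fun i _ => (hmX i).comap_le
  set G := stayEvent X c r m with hG
  set G' := stayEvent X c r (m + 1) with hG'
  have hGm : MeasurableSet G := hσ _ (measurableSet_stayEvent X c r m)
  have hGX : ∀ ω ∈ G, X m ω ∈ Metric.ball (c m) r := fun ω hω => by
    rw [Metric.mem_ball, dist_eq_norm]
    exact hω m le_rfl
  have hlyap : Measurable (lyapunov : E d → ℝ) := continuous_lyapunov.measurable
  have hV : Measurable fun ω => ENNReal.ofReal (lyapunov (X (m + 1) ω - c (m + 1))) :=
    (hlyap.comp ((hmX (m + 1)).sub_const _)).ennreal_ofReal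
  set U := Metric.ball (c m) r with hU
  have hUm : MeasurableSet U := Metric.isOpen_ball.measurableSet
  set κ := reversedKernel hρ ε x₀ n hUm with hκ
  have hκfin : IsFiniteKernel κ := isFiniteKernel_reversedKernel hρ ε x₀ n hUm hprob
  have hZ : Measurable fun ω => ε⁻¹ • (X (m + 1) ω - X m ω) := by
    have hdiff : Measurable fun ω => X (m + 1) ω - X m ω := (hmX (m + 1)).sub (hmX m)
    exact hdiff.const_smul ε⁻¹
  have hf : Measurable fun q : E d × E d =>
      ENNReal.ofReal (lyapunov (q.1 + ε • q.2 - c (m + 1))) :=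
    (hlyap.comp (by fun_prop)).ennreal_ofReal
  have hjump : ∫⁻ ω in G, ENNReal.ofReal (lyapunov (X (m + 1) ω - c (m + 1))) ∂P =
      ∫⁻ ω in G, ∫⁻ z, ENNReal.ofReal (lyapunov (X m ω + ε • z - c (m + 1))) ∂(κ (X m ω)) ∂P := by
    rw [← setLIntegral_jump_eq (hmX m) hZ κ ?_ hf]
    · refine lintegral_congr fun ω => ?_
      simp only [smul_smul, mul_inv_cancel₀ hε, one_smul, add_sub_cancel]
    · intro B D hB hD
      have hGB : MeasurableSet[⨆ (i : ℕ) (_ : i ≤ m), MeasurableSpace.comap (X i) inferInstance]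
          (G ∩ X m ⁻¹' B) := by
        refine MeasurableSet.inter (measurableSet_stayEvent X c r m) ?_
        have hle : MeasurableSpace.comap (X m) inferInstance ≤
            ⨆ (i : ℕ) (_ : i ≤ m), MeasurableSpace.comap (X i) inferInstance :=
          le_iSup₂_of_le m le_rfl le_rfl
        exact hle _ ⟨B, hB, rfl⟩
      refine (hX.jump m (by omega) _ hGB D hD).trans ?_
      refine setLIntegral_congr_fun (hσ _ hGB) fun ω hω => ?_
      simp only [hκ, hn]
      rw [reversedKernel_apply hρ ε x₀ n hUm (hGX ω hω.1)]
  have hone : ∫⁻ ω in G, ENNReal.ofReal (lyapunov (X (m + 1) ω - c (m + 1))) ∂P ≤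
      K * ∫⁻ ω in G, ENNReal.ofReal (lyapunov (X m ω - c m)) ∂P + e := by
    have hVm : Measurable fun ω => ENNReal.ofReal (lyapunov (X m ω - c m)) :=
      (hlyap.comp ((hmX m).sub_const _)).ennreal_ofReal
    rw [hjump]
    calc _ ≤ ∫⁻ ω in G, (K * ENNReal.ofReal (lyapunov (X m ω - c m)) + e) ∂P := by
          refine setLIntegral_mono' hGm fun ω hω => ?_
          rw [hκ, reversedKernel_apply hρ ε x₀ n hUm (hGX ω hω)]
          exact hstep _ (hGX ω hω)
      _ = K * ∫⁻ ω in G, ENNReal.ofReal (lyapunov (X m ω - c m)) ∂P + e * P G := by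
          rw [lintegral_add_right _ measurable_const, lintegral_const_mul _ hVm, setLIntegral_const]
      _ ≤ _ := by
          gcongr
          exact mul_le_of_le_one_right' prob_le_one
  have hsub : G' ⊆ G := by rw [hG', stayEvent_succ]; exact inter_subset_left
  have hlast : MeasurableSet {ω | ‖X (m + 1) ω - c (m + 1)‖ < r} :=
    measurableSet_lt ((hmX (m + 1)).sub_const _).norm measurable_const
  have hG'm : MeasurableSet G' := by
    rw [hG', stayEvent_succ]
    exact hGm.inter hlast
  have hsplit : ∫⁻ ω in G', ENNReal.ofReal (lyapunov (X (m + 1) ω - c (m + 1))) ∂P +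
      ENNReal.ofReal w * P (G \ G') ≤
      ∫⁻ ω in G, ENNReal.ofReal (lyapunov (X (m + 1) ω - c (m + 1))) ∂P := by
    rw [← lintegral_inter_add_sdiff _ G hG'm, inter_eq_self_of_subset_right hsub]
    gcongr
    rw [← setLIntegral_const]
    refine setLIntegral_mono' (hGm.diff hG'm) fun ω hω => ENNReal.ofReal_le_ofReal (hw _ ?_)
    by_contra hlt
    refine hω.2 ?_
    rw [hG', stayEvent_succ]
    exact ⟨hω.1, not_le.1 hlt⟩
  have hcompl : P G'ᶜ ≤ P (G \ G') + P Gᶜ := by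
    refine (measure_mono fun ω hω => ?_).trans (measure_union_le _ _)
    by_cases h : ω ∈ G
    · exact Or.inl ⟨h, hω⟩
    · exact Or.inr h
  calc stoppedLyapunov P X c r w (m + 1)
      ≤ ∫⁻ ω in G', ENNReal.ofReal (lyapunov (X (m + 1) ω - c (m + 1))) ∂P +
          ENNReal.ofReal w * (P (G \ G') + P Gᶜ) := by
        unfold stoppedLyapunov
        gcongr
    _ = ∫⁻ ω in G', ENNReal.ofReal (lyapunov (X (m + 1) ω - c (m + 1))) ∂P +
          ENNReal.ofReal w * P (G \ G') + ENNReal.ofReal w * P Gᶜ := by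
        rw [mul_add, add_assoc]
    _ ≤ K * ∫⁻ ω in G, ENNReal.ofReal (lyapunov (X m ω - c m)) ∂P + e +
          K * (ENNReal.ofReal w * P Gᶜ) :=
        add_le_add (hsplit.trans hone) (le_mul_of_one_le_left' hK)
    _ = K * stoppedLyapunov P X c r w m + e := by
        unfold stoppedLyapunov
        ring

/-- Probability of leaving the tube within `M` steps. -/
lemma IsReversedChain.measure_stayEvent_compl_le {ρ : E d → E d → ℝ≥0∞}
    (hρ : Measurable (Function.uncurry ρ)) {T ε : ℝ} (hε : ε ≠ 0) {x₀ xT : E d} {X : ℕ → Ω → E d}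
    (hX : IsReversedChain P ρ T ε x₀ xT X) {c : ℕ → E d} {r w : ℝ}
    (hw : ∀ y : E d, r ≤ ‖y‖ → w ≤ lyapunov y) {M : ℕ} (hM : M + 1 ≤ ⌊T / ε⌋₊)
    (hprob : ∀ m < M, ∀ x ∈ Metric.ball (c m) r,
      reversedJumpLaw ρ ε x₀ (⌊T / ε⌋₊ - m) x univ = 1)
    {K e : ℝ≥0∞} (hK : 1 ≤ K)
    (hstep : ∀ m < M, ∀ x ∈ Metric.ball (c m) r,
      ∫⁻ z, ENNReal.ofReal (lyapunov (x + ε • z - c (m + 1)))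
          ∂(reversedJumpLaw ρ ε x₀ (⌊T / ε⌋₊ - m) x) ≤
        K * ENNReal.ofReal (lyapunov (x - c m)) + e) :
    ENNReal.ofReal w * P (stayEvent X c r M)ᶜ ≤
      K ^ M * (ENNReal.ofReal (lyapunov (xT - c 0)) + M * e) := by
  have hind : ∀ m ≤ M, stoppedLyapunov P X c r w m ≤
      K ^ m * (ENNReal.ofReal (lyapunov (xT - c 0)) + m * e) := by
    intro m
    induction m with
    | zero =>
      intro _
      have hlyap : Measurable (lyapunov : E d → ℝ) := continuous_lyapunov.measurable
      have hmX := hX.measurable 0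
      have h0 : stayEvent X c r 0 = {ω | ‖X 0 ω - c 0‖ < r} := by
        ext ω
        simp [stayEvent]
      have h0m : MeasurableSet (stayEvent X c r 0) := by
        rw [h0]
        exact measurableSet_lt (hmX.sub_const _).norm measurable_const
      have hexit : ENNReal.ofReal w * P (stayEvent X c r 0)ᶜ ≤
          ∫⁻ ω in (stayEvent X c r 0)ᶜ, ENNReal.ofReal (lyapunov (X 0 ω - c 0)) ∂P := by
        rw [← setLIntegral_const]
        refine setLIntegral_mono' h0m.compl fun ω hω => ENNReal.ofReal_le_ofReal (hw _ ?_)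
        rw [h0] at hω
        exact not_lt.1 hω
      calc stoppedLyapunov P X c r w 0
          ≤ ∫⁻ ω in stayEvent X c r 0, ENNReal.ofReal (lyapunov (X 0 ω - c 0)) ∂P +
            ∫⁻ ω in (stayEvent X c r 0)ᶜ, ENNReal.ofReal (lyapunov (X 0 ω - c 0)) ∂P :=
            add_le_add le_rfl hexit
        _ = ∫⁻ ω, ENNReal.ofReal (lyapunov (X 0 ω - c 0)) ∂P := lintegral_add_compl _ h0m
        _ = ∫⁻ _, ENNReal.ofReal (lyapunov (xT - c 0)) ∂P := by
            refine lintegral_congr_ae ?_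
            filter_upwards [hX.initial] with ω hω
            rw [hω]
        _ = _ := by simp
    | succ m ih =>
      intro hm
      obtain ⟨n, hn⟩ : ∃ n, ⌊T / ε⌋₊ - m = n + 2 := ⟨⌊T / ε⌋₊ - m - 2, by omega⟩
      have h1 := hprob m (by omega)
      have h2 := hstep m (by omega)
      rw [hn] at h1 h2
      refine (hX.stoppedLyapunov_succ_le hρ hε hw hn h1 hK h2).trans ?_
      calc K * stoppedLyapunov P X c r w m + e
          ≤ K * (K ^ m * (ENNReal.ofReal (lyapunov (xT - c 0)) + m * e)) + K ^ (m + 1) * e := by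
            gcongr
            · exact ih (by omega)
            · exact le_mul_of_one_le_left' (one_le_pow₀ hK)
        _ = _ := by
            push_cast
            ring
  exact le_add_self.trans (hind M le_rfl)

end Chain

/-! ### The time grid and the choice of constants -/

section Grid

lemma offset_nonneg {T ε : ℝ} (hT : 0 ≤ T) (hε : 0 < ε) : 0 ≤ offset T ε := by
  have := Nat.floor_le (div_nonneg hT hε.le)
  rw [le_div_iff₀ hε] at this
  exact sub_nonneg.2 this

lemma offset_lt {T ε : ℝ} (hε : 0 < ε) : offset T ε < ε := by
  have := Nat.lt_floor_add_one (T / ε)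
  rw [div_lt_iff₀ hε] at this
  unfold offset
  linarith

lemma natCast_floor_sub_mul {T ε : ℝ} {m : ℕ} (hm : m ≤ ⌊T / ε⌋₊) :
    ((⌊T / ε⌋₊ - m : ℕ) : ℝ) * ε = T - (offset T ε + m * ε) := by
  rw [Nat.cast_sub hm, offset]
  ring

lemma add_le_floor_of_grid_le {T ε : ℝ} (hε : 0 < ε) {m : ℕ} (k : ℕ)
    (h : offset T ε + m * ε + k * ε ≤ T) : m + k ≤ ⌊T / ε⌋₊ := by
  have h1 : ((m + k : ℕ) : ℝ) * ε ≤ (⌊T / ε⌋₊ : ℝ) * ε := by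
    unfold offset at h
    push_cast
    linarith
  exact_mod_cast le_of_mul_le_mul_right h1 hε

lemma grid_lt_of_lt_ceil {T ε t : ℝ} (hε : 0 < ε) {m : ℕ} (hm : m < ⌈(t - offset T ε) / ε⌉₊) :
    offset T ε + m * ε < t := by
  rw [Nat.lt_ceil, lt_div_iff₀ hε] at hm
  linarith

/-- The grid point used by the step process at time `t` is within `ε` of `t`. -/
lemma abs_grid_ceil_sub_lt {T ε t : ℝ} (hT : 0 ≤ T) (hε : 0 < ε) (ht : 0 ≤ t) :
    |offset T ε + ⌈(t - offset T ε) / ε⌉₊ * ε - t| < ε := by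
  have hΔ0 := offset_nonneg hT hε
  have hΔ := offset_lt (T := T) hε
  rcases le_total t (offset T ε) with h | h
  · have h0 : ⌈(t - offset T ε) / ε⌉₊ = 0 :=
      Nat.ceil_eq_zero.2 (div_nonpos_of_nonpos_of_nonneg (by linarith) hε.le)
    rw [h0, Nat.cast_zero, zero_mul, add_zero, abs_of_nonneg (by linarith)]
    linarith
  · have h0 : 0 ≤ (t - offset T ε) / ε := div_nonneg (by linarith) hε.le
    have h1 := Nat.le_ceil ((t - offset T ε) / ε)
    have h2 := Nat.ceil_lt_add_one h0
    rw [div_le_iff₀ hε] at h1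
    rw [← sub_lt_iff_lt_add, lt_div_iff₀ hε] at h2
    rw [abs_of_nonneg (by linarith)]
    linarith

end Grid

section Step

variable {F : Type*} [NormedAddCommGroup F] [InnerProductSpace ℝ F] [MeasurableSpace F]
  [BorelSpace F] [SecondCountableTopology F] [CompleteSpace F]

/-- One jump of the chain against one step of the limiting path. The mean jump is close to `-g`, the
drift `-g` is compared with the drift `-g₀` on the path, and the path moves from `c` to `c'`. -/
lemma lintegral_lyapunov_step_le {ν : Measure F} [IsProbabilityMeasure ν]
    (hint : Integrable (fun z : F => z) ν) {κ : ℝ} (hκ : κ ∈ Ioc (0 : ℝ) 1) {G : ℝ≥0}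
    (hG : ∫⁻ z, ‖z - ∫ w, w ∂ν‖ₑ ^ (1 + κ) ∂ν ≤ G) {ε C η : ℝ} (hε : 0 ≤ ε) (hC : 0 ≤ C)
    (hη : 0 ≤ η) {x c c' g g₀ : F} (hb : ‖(∫ w, w ∂ν) - -g‖ ≤ η) (hg : ‖g - g₀‖ ≤ C * ‖x - c‖)
    (hc : ‖c' - (c - ε • g₀)‖ ≤ η * ε) :
    ∫⁻ z, ENNReal.ofReal (lyapunov (x + ε • z - c')) ∂ν ≤
      ENNReal.ofReal ((1 + ε * C) ^ 2) * ENNReal.ofReal (lyapunov (x - c)) +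
        ENNReal.ofReal (2 * ε * η + 2 * ε ^ (1 + κ) * G) := by
  have h1 := lintegral_lyapunov_add_smul_le hint hκ hG hε (x - c')
  set b := ∫ w, w ∂ν with hbdef
  have e1 : ∀ z : F, x + ε • z - c' = x - c' + ε • z := fun z => by abel
  simp only [e1]
  refine h1.trans ?_
  have hnorm : ‖x - c' + ε • b‖ ≤ (1 + ε * C) * ‖x - c‖ + 2 * ε * η := by
    have e2 : x - c' + ε • b =
        (x - c) + ε • (b - -g) - ε • (g - g₀) - (c' - (c - ε • g₀)) := by module
    rw [e2]
    have n1 := norm_sub_le ((x - c) + ε • (b - -g) - ε • (g - g₀)) (c' - (c - ε • g₀))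
    have n2 := norm_sub_le ((x - c) + ε • (b - -g)) (ε • (g - g₀))
    have n3 := norm_add_le (x - c) (ε • (b - -g))
    rw [norm_smul, Real.norm_of_nonneg hε] at n2 n3
    have m1 := mul_le_mul_of_nonneg_left hb hε
    have m2 := mul_le_mul_of_nonneg_left hg hε
    linarith
  have hl := lyapunov_le_of_norm_le (mul_nonneg hε hC) (by positivity) hnorm
  rw [← ENNReal.ofReal_mul (by positivity),
    ← ENNReal.ofReal_add (mul_nonneg (by positivity) (lyapunov_nonneg _)) (by positivity)]
  exact ENNReal.ofReal_le_ofReal (by linarith)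

end Step

/-- On the event that the chain stays in the tube, the step process stays within `δ` of the path. -/
lemma iSup_reversedPath_le {d : ℕ} {Ω : Type*} {T ε r δ Tstar : ℝ} {X : ℕ → Ω → E d}
    {φ : ℝ → E d} (hT : 0 ≤ T) (hε : 0 < ε) (hr : r ≤ δ / 2)
    (hosc : ∀ t ∈ Icc 0 Tstar, ∀ u, |u - t| < ε → 0 ≤ u → ‖φ (T - u) - φ (T - t)‖ ≤ δ / 2) {ω : Ω}
    (hω : ω ∈ stayEvent X (fun m => φ (T - (offset T ε + m * ε))) r
      ⌈(Tstar - offset T ε) / ε⌉₊) :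
    ⨆ t ∈ Icc 0 Tstar, ‖reversedPath T ε X t ω - φ (T - t)‖ₑ ≤ ENNReal.ofReal δ := by
  refine iSup₂_le fun t ht => ?_
  set m := ⌈(t - offset T ε) / ε⌉₊ with hm
  have hmM : m ≤ ⌈(Tstar - offset T ε) / ε⌉₊ :=
    Nat.ceil_mono (div_le_div_of_nonneg_right (by linarith [ht.2]) hε.le)
  have h1 := hω m hmM
  have h2 := hosc t ht _ (abs_grid_ceil_sub_lt hT hε ht.1)
    (add_nonneg (offset_nonneg hT hε) (by positivity))
  rw [← ofReal_norm]
  refine ENNReal.ofReal_le_ofReal ?_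
  have h3 := norm_sub_le_norm_sub_add_norm_sub (X m ω) (φ (T - (offset T ε + m * ε))) (φ (T - t))
  change ‖X m ω - φ (T - t)‖ ≤ δ
  linarith

/-! ### The law of large numbers -/

/-- Quantitative exit estimate: if up to time `Tstar` all errors (of the drift, of one step of the
limiting path, of the starting point and of the moment term) are at most `η`, then the probability of
leaving the tube is of order `η`. -/
lemma IsReversedChain.exit_le {d : ℕ} {μ : Kernel (E d) (E d)} {ρ : E d → E d → ℝ≥0∞}
    (hρ : Measurable (Function.uncurry ρ)) {Ω : Type*} [MeasurableSpace Ω] {P : Measure Ω}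
    [IsProbabilityMeasure P] {T ε Tstar : ℝ} (hε : 0 < ε) (hTs : 0 ≤ Tstar)
    (hsmall : Tstar + 2 * ε ≤ T) {x₀ xT : E d} {X : ℕ → Ω → E d}
    (hX : IsReversedChain P ρ T ε x₀ xT X) {φ : ℝ → E d} {r w C η κ : ℝ} {G : ℝ≥0}
    (hC : 0 ≤ C) (hη : 0 ≤ η) (hκ : κ ∈ Ioc (0 : ℝ) 1)
    (hw : ∀ y : E d, r ≤ ‖y‖ → w ≤ lyapunov y)
    (hprob : ∀ m : ℕ, offset T ε + m * ε ≤ Tstar →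
      ∀ x ∈ Metric.ball (φ (T - (offset T ε + m * ε))) r,
        reversedJumpLaw ρ ε x₀ (⌊T / ε⌋₊ - m) x univ = 1)
    (hint : ∀ m : ℕ, offset T ε + m * ε ≤ Tstar →
      ∀ x ∈ Metric.ball (φ (T - (offset T ε + m * ε))) r,
        ∫⁻ z, ‖z‖ₑ ∂(reversedJumpLaw ρ ε x₀ (⌊T / ε⌋₊ - m) x) < ⊤)
    (hdrift : ∀ m : ℕ, offset T ε + m * ε ≤ Tstar →
      ∀ x ∈ Metric.ball (φ (T - (offset T ε + m * ε))) r,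
        ‖reversedDrift ρ T ε x₀ m x - limitDrift μ T x₀ x (offset T ε + m * ε)‖ ≤ η)
    (hmom : ∀ m : ℕ, offset T ε + m * ε ≤ Tstar →
      ∀ x ∈ Metric.ball (φ (T - (offset T ε + m * ε))) r,
        ∫⁻ z, ‖z - reversedDrift ρ T ε x₀ m x‖ₑ ^ (1 + κ)
          ∂(reversedJumpLaw ρ ε x₀ (⌊T / ε⌋₊ - m) x) ≤ G)
    (hlip : ∀ s, T - Tstar ≤ s → s ≤ T → ∀ x ∈ Metric.ball (φ s) r,
      ‖charVelocity μ x₀ (x, s) - charVelocity μ x₀ (φ s, s)‖ ≤ C * ‖x - φ s‖)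
    (hexp : ∀ s, T - Tstar ≤ s → s ≤ T →
      ‖φ (s - ε) - (φ s - ε • charVelocity μ x₀ (φ s, s))‖ ≤ η * ε)
    (hstart : ‖xT - φ (T - offset T ε)‖ ≤ η) (hκη : ε ^ κ * G ≤ η) :
    ENNReal.ofReal w * P (stayEvent X (fun m => φ (T - (offset T ε + m * ε))) r
        ⌈(Tstar - offset T ε) / ε⌉₊)ᶜ ≤
      ENNReal.ofReal (Real.exp (2 * C * T) * ((1 + 4 * T) * η)) := by
  have hT : 0 ≤ T := by linarith
  set c : ℕ → E d := fun m => φ (T - (offset T ε + m * ε)) with hc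
  set M := ⌈(Tstar - offset T ε) / ε⌉₊ with hM
  have hΔ := offset_nonneg hT hε
  -- The last grid point exceeds `Tstar` by less than `ε`, so at least one forward step remains there
  -- and at least two remain at the earlier grid points.
  have hgridM : offset T ε + M * ε < Tstar + ε := by
    have := (abs_lt.1 (abs_grid_ceil_sub_lt (T := T) (t := Tstar) hT hε hTs)).2
    linarith
  have hMN : M + 1 ≤ ⌊T / ε⌋₊ := by
    refine add_le_floor_of_grid_le hε 1 ?_
    push_cast
    linarith
  have hMε : M * ε ≤ T := by linarith
  have hgrid : ∀ m < M, offset T ε + m * ε ≤ Tstar := fun m hm => (grid_lt_of_lt_ceil hε hm).le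
  have hK : (1 : ℝ≥0∞) ≤ ENNReal.ofReal ((1 + ε * C) ^ 2) := by
    rw [ENNReal.one_le_ofReal]
    exact one_le_pow₀ (by nlinarith)
  have hexit := hX.measure_stayEvent_compl_le hρ hε.ne' hw hMN (c := c)
    (fun m hm => hprob m (hgrid m hm)) hK
    (e := ENNReal.ofReal (2 * ε * η + 2 * ε ^ (1 + κ) * G)) (fun m hm x hx => by
      have ht := hgrid m hm
      have hνp : IsProbabilityMeasure (reversedJumpLaw ρ ε x₀ (⌊T / ε⌋₊ - m) x) :=
        ⟨hprob m ht x hx⟩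
      have hs1 : T - Tstar ≤ T - (offset T ε + m * ε) := by linarith
      have hs2 : T - (offset T ε + m * ε) ≤ T := by
        have : 0 ≤ m * ε := by positivity
        linarith
      refine lintegral_lyapunov_step_le (g := charVelocity μ x₀ (x, T - (offset T ε + m * ε)))
        ⟨aestronglyMeasurable_id, hint m ht x hx⟩ hκ (hmom m ht x hx) hε.le hC hη
        (by
          have := hdrift m ht x hx
          rwa [limitDrift_eq_neg_charVelocity] at this) (hlip _ hs1 hs2 x hx) ?_
      have := hexp _ hs1 hs2
      have e : T - (offset T ε + m * ε) - ε = T - (offset T ε + (m + 1 : ℕ) * ε) := by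
        push_cast
        ring
      rwa [e] at this)
  refine hexit.trans ?_
  have hc0 : c 0 = φ (T - offset T ε) := by simp [hc]
  have hl0 : lyapunov (xT - c 0) ≤ η := by
    have := lyapunov_le_of_norm_le (y := (0 : E d)) (y' := xT - c 0) le_rfl hη
      (by rw [hc0]; simpa using hstart)
    simpa [lyapunov] using this
  have herr : 2 * ε * η + 2 * ε ^ (1 + κ) * G ≤ ε * (4 * η) := by
    rw [Real.rpow_add hε, Real.rpow_one]
    nlinarith [mul_le_mul_of_nonneg_left hκη hε.le]
  have hsum : ENNReal.ofReal (lyapunov (xT - c 0)) +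
      M * ENNReal.ofReal (2 * ε * η + 2 * ε ^ (1 + κ) * G) ≤ ENNReal.ofReal ((1 + 4 * T) * η) := by
    rw [← ENNReal.ofReal_natCast, ← ENNReal.ofReal_mul (Nat.cast_nonneg _),
      ← ENNReal.ofReal_add (lyapunov_nonneg _) (by positivity)]
    refine ENNReal.ofReal_le_ofReal ?_
    have h1 := mul_le_mul_of_nonneg_left herr (Nat.cast_nonneg (α := ℝ) M)
    have h2 := mul_le_mul_of_nonneg_right hMε (by linarith : 0 ≤ 4 * η)
    linarith
  have hpow : ENNReal.ofReal ((1 + ε * C) ^ 2) ^ M ≤ ENNReal.ofReal (Real.exp (2 * C * T)) := by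
    rw [← ENNReal.ofReal_pow (by positivity)]
    refine ENNReal.ofReal_le_ofReal ?_
    have h1 : 1 + ε * C ≤ Real.exp (ε * C) := by
      have := Real.add_one_le_exp (ε * C)
      linarith
    have h0 : 0 ≤ 1 + ε * C := by positivity
    calc ((1 + ε * C) ^ 2) ^ M ≤ (Real.exp (ε * C) ^ 2) ^ M := by gcongr
      _ = Real.exp (2 * C * (M * ε)) := by
          rw [← pow_mul, ← Real.exp_nat_mul]
          push_cast
          ring_nf
      _ ≤ _ := by gcongr
  rw [ENNReal.ofReal_mul (Real.exp_pos _).le]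
  exact mul_le_mul' hpow hsum

end JumpReversal

/-- Law of large numbers for the time-reversed jump process conditioned to start at `xT`. -/
theorem mainTheorem1 {d : ℕ}
    -- jump laws, with (jointly measurable) Lebesgue densities
    (μ : Kernel (JumpReversal.E d) (JumpReversal.E d)) [IsMarkovKernel μ]
    (ρ : JumpReversal.E d → JumpReversal.E d → ℝ≥0∞)
    (hρ : Measurable (Function.uncurry ρ))
    (hμρ : ∀ x, μ x = (volume : Measure (JumpReversal.E d)).withDensity (ρ x))
    -- time span, end points and optimal path
    (T : ℝ) (hT : 0 < T) (x₀ xT : JumpReversal.E d) (φ : ℝ → JumpReversal.E d)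
    (hφ : JumpReversal.IsNOP μ T x₀ xT φ)
    (hsub : JumpReversal.IsProperSubarc μ T φ)
    -- conditions on the Hamiltonian and the Lagrangian
    (hLDP : JumpReversal.LDPConditions μ)
    (hH : ContDiff ℝ 2 fun p : JumpReversal.E d × JumpReversal.E d =>
      JumpReversal.hamiltonianR μ p.1 p.2)
    -- near the path: smoothness of `S`, positive continuous finite densities at the grid times
    (hS : ∀ Tstar ∈ Ioo 0 T, ∃ δ₀ > 0,
      ContDiffOn ℝ 2
          (fun p : JumpReversal.E d × ℝ => JumpReversal.quasiPotentialR μ x₀ p.1 p.2)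
          (JumpReversal.tube φ δ₀ (T - Tstar) T ×ˢ Icc (T - Tstar) T) ∧
      ∀ᶠ ε in 𝓝[>] (0 : ℝ), ∀ n : ℕ, (n : ℝ) * ε ∈ Icc (T - Tstar) T →
        ContinuousOn (JumpReversal.forwardDensity ρ ε x₀ n)
          (JumpReversal.tube φ δ₀ (T - Tstar) T) ∧
        ∀ x ∈ JumpReversal.tube φ δ₀ (T - Tstar) T,
          0 < JumpReversal.forwardDensity ρ ε x₀ n x ∧
          JumpReversal.forwardDensity ρ ε x₀ n x < ⊤)
    -- moment bounds and convergence of the mean drift near the path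
    (hmom : ∀ Tstar ∈ Ioo 0 T, ∃ δ₀ > 0,
      (∃ G₁ : ℝ≥0, ∀ᶠ ε in 𝓝[>] (0 : ℝ), ∀ m : ℕ,
        JumpReversal.offset T ε + m * ε ≤ Tstar →
        ∀ x ∈ JumpReversal.tube φ δ₀ (T - Tstar) T,
          ∫⁻ z, ‖z‖ₑ ∂(JumpReversal.reversedJumpLaw ρ ε x₀ (⌊T / ε⌋₊ - m) x) ≤ G₁) ∧
      (∀ η > 0, ∀ᶠ ε in 𝓝[>] (0 : ℝ), ∀ m : ℕ,
        JumpReversal.offset T ε + m * ε ≤ Tstar →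
        ∀ x ∈ JumpReversal.tube φ δ₀ (T - Tstar) T,
          ‖JumpReversal.reversedDrift ρ T ε x₀ m x -
            JumpReversal.limitDrift μ T x₀ x (JumpReversal.offset T ε + m * ε)‖ < η) ∧
      (∃ κ ∈ Ioc (0 : ℝ) 1, ∃ G₂ : ℝ≥0, ∀ᶠ ε in 𝓝[>] (0 : ℝ), ∀ m : ℕ,
        JumpReversal.offset T ε + m * ε ≤ Tstar →
        ∀ x ∈ JumpReversal.tube φ δ₀ (T - Tstar) T,
          ∫⁻ z, ‖z - JumpReversal.reversedDrift ρ T ε x₀ m x‖ₑ ^ (1 + κ)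
            ∂(JumpReversal.reversedJumpLaw ρ ε x₀ (⌊T / ε⌋₊ - m) x) ≤ G₂))
    -- the reversed processes started at `xT`, for small `ε`
    {Ω : ℝ → Type*} [∀ ε, MeasurableSpace (Ω ε)] (P : ∀ ε, Measure (Ω ε))
    [∀ ε, IsProbabilityMeasure (P ε)] (X : ∀ ε, ℕ → Ω ε → JumpReversal.E d)
    (hX : ∀ᶠ ε in 𝓝[>] (0 : ℝ),
      JumpReversal.IsReversedChain (P ε) ρ T ε x₀ xT (X ε)) :
    ∀ Tstar ∈ Ioo 0 T, ∀ δ : ℝ, 0 < δ →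
      Tendsto
        (fun ε : ℝ => P ε {ω | ENNReal.ofReal δ <
          ⨆ t ∈ Icc 0 Tstar, ‖JumpReversal.reversedPath T ε (X ε) t ω - φ (T - t)‖ₑ})
        (𝓝[>] 0) (𝓝 0) := by
  intro Tstar hTstar δ hδ
  -- The tube and the estimates are used on a slightly longer time interval, because the last grid
  -- point may exceed `Tstar`.
  set T' := (T + Tstar) / 2 with hT'
  have hT'mem : T' ∈ Ioo 0 T := ⟨by linarith [hTstar.1], by linarith [hTstar.2]⟩
  have hgap : Tstar < T' := by linarith [hTstar.2]
  set a := T - T' with ha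
  have ha0 : 0 < a := sub_pos.2 hT'mem.2
  have haT : a < T := by linarith [hT'mem.1]
  obtain ⟨δ₁, hδ₁, hSd, hdens⟩ := hS T' hT'mem
  obtain ⟨δ₂, hδ₂, ⟨G₁, hG₁⟩, hdrift, κ, hκ, G₂, hG₂⟩ := hmom T' hT'mem
  have hopen := JumpReversal.isOpen_tube φ δ₁ a T
  have hφtube : ∀ s ∈ Icc a T, φ s ∈ JumpReversal.tube φ δ₁ a T := fun s hs =>
    JumpReversal.ball_subset_tube φ δ₁ hs (Metric.mem_ball_self hδ₁)
  have hφ0 : ContinuousOn φ (Icc 0 T) := by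
    have := hφ.absolutelyContinuousOnInterval.continuousOn
    rwa [uIcc_of_le hT.le] at this
  set r := min (δ / 2) (min δ₁ δ₂ / 2) with hr
  have hr0 : 0 < r := lt_min (by linarith) (half_pos (lt_min hδ₁ hδ₂))
  have hrδ : r ≤ δ / 2 := min_le_left _ _
  have hrδ₁ : r < δ₁ := by
    linarith [min_le_left δ₁ δ₂, min_le_right (δ / 2) (min δ₁ δ₂ / 2), half_lt_self (lt_min hδ₁ hδ₂)]
  have hrδ₂ : r < δ₂ := by
    linarith [min_le_right δ₁ δ₂, min_le_right (δ / 2) (min δ₁ δ₂ / 2), half_lt_self (lt_min hδ₁ hδ₂)]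
  obtain ⟨C, hC, hlip⟩ := JumpReversal.exists_lipschitz_near_curve hopen haT
    (JumpReversal.contDiffOn_charVelocity hopen haT hH hSd)
    (hφ0.mono (Icc_subset_Icc ha0.le le_rfl)) hr0.le (fun s hs =>
      (Metric.closedBall_subset_ball hrδ₁).trans (JumpReversal.ball_subset_tube φ δ₁ hs))
  set w := √(1 + r ^ 2) - 1 with hw
  have hw0 : 0 < w := sub_pos.2 (Real.lt_sqrt_of_sq_lt (by nlinarith))
  have hwl : ∀ y : JumpReversal.E d, r ≤ ‖y‖ → w ≤ JumpReversal.lyapunov y := by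
    intro y hy
    unfold JumpReversal.lyapunov
    rw [hw]
    gcongr
  rw [ENNReal.tendsto_nhds_zero]
  intro θ hθ
  obtain ⟨θ', hθ'0, hθ'⟩ : ∃ θ' : ℝ, 0 < θ' ∧ ENNReal.ofReal θ' ≤ θ := by
    obtain ⟨q, hq0, hq⟩ := ENNReal.lt_iff_exists_nnreal_btwn.1 hθ
    exact ⟨q, by exact_mod_cast hq0, by simpa using hq.le⟩
  -- The common bound `η` on all errors is chosen so that the exit probability is at most `θ'`.
  set B := Real.exp (2 * C * T) * (1 + 4 * T) with hB
  have hB0 : 0 < B := by positivity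
  set η := θ' * w / B with hη
  have hη0 : 0 < η := by positivity
  obtain ⟨h₀, hh₀, hexp⟩ := hφ.exists_expansion hLDP hH hopen ha0.le haT hSd hφtube hη0
  have huc := isCompact_Icc.uniformContinuousOn_of_continuous hφ0
  rw [Metric.uniformContinuousOn_iff] at huc
  obtain ⟨h₁, hh₁, huc⟩ := huc (min (δ / 2) η) (lt_min (by linarith) hη0)
  have hsmall : ∀ᶠ ε in 𝓝[>] (0 : ℝ), ε < min (min h₀ h₁) ((T - T') / 2) :=
    mem_nhdsWithin_of_mem_nhds (Iio_mem_nhds (lt_min (lt_min hh₀ hh₁) (by linarith)))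
  have hκη : ∀ᶠ ε in 𝓝[>] (0 : ℝ), ε ^ κ * G₂ < η := by
    have hcont : Tendsto (fun ε : ℝ => ε ^ κ * G₂) (𝓝 0) (𝓝 ((0 : ℝ) ^ κ * G₂)) :=
      ((Real.continuous_rpow_const hκ.1.le).mul continuous_const).tendsto 0
    rw [Real.zero_rpow hκ.1.ne', zero_mul] at hcont
    exact (hcont.mono_left nhdsWithin_le_nhds).eventually (gt_mem_nhds hη0)
  filter_upwards [hX, hdens, hG₁, hdrift η hη0, hG₂, hsmall, hκη, self_mem_nhdsWithin]
    with ε hXε hdensε hG₁ε hdriftε hG₂ε hsmallε hκηε hε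
  have hε : 0 < ε := hε
  have hεh₀ : ε < h₀ := hsmallε.trans_le ((min_le_left _ _).trans (min_le_left _ _))
  have hεh₁ : ε < h₁ := hsmallε.trans_le ((min_le_left _ _).trans (min_le_right _ _))
  have hεT : ε < (T - T') / 2 := hsmallε.trans_le (min_le_right _ _)
  have hΔ0 := JumpReversal.offset_nonneg hT.le hε
  have hΔ := JumpReversal.offset_lt (T := T) hε
  have hs : ∀ m : ℕ, JumpReversal.offset T ε + m * ε ≤ Tstar →
      T - (JumpReversal.offset T ε + m * ε) ∈ Icc a T := by
    intro m hm
    have : 0 ≤ m * ε := by positivity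
    exact ⟨by linarith, by linarith⟩
  have htube₁ : ∀ m : ℕ, JumpReversal.offset T ε + m * ε ≤ Tstar →
      Metric.ball (φ (T - (JumpReversal.offset T ε + m * ε))) r ⊆ JumpReversal.tube φ δ₁ a T :=
    fun m hm => (Metric.ball_subset_ball hrδ₁.le).trans
      (JumpReversal.ball_subset_tube φ δ₁ (hs m hm))
  have htube₂ : ∀ m : ℕ, JumpReversal.offset T ε + m * ε ≤ Tstar →
      Metric.ball (φ (T - (JumpReversal.offset T ε + m * ε))) r ⊆ JumpReversal.tube φ δ₂ a T :=
    fun m hm => (Metric.ball_subset_ball hrδ₂.le).trans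
      (JumpReversal.ball_subset_tube φ δ₂ (hs m hm))
  have hprob : ∀ m : ℕ, JumpReversal.offset T ε + m * ε ≤ Tstar →
      ∀ x ∈ Metric.ball (φ (T - (JumpReversal.offset T ε + m * ε))) r,
        JumpReversal.reversedJumpLaw ρ ε x₀ (⌊T / ε⌋₊ - m) x univ = 1 := by
    intro m hm x hx
    have hN : m + 2 ≤ ⌊T / ε⌋₊ :=
      JumpReversal.add_le_floor_of_grid_le hε 2 (by push_cast; linarith)
    have hgrid := JumpReversal.natCast_floor_sub_mul (T := T) (ε := ε) (m := m) (by omega)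
    obtain ⟨n, hn⟩ : ∃ n, ⌊T / ε⌋₊ - m = n + 2 := ⟨⌊T / ε⌋₊ - m - 2, by omega⟩
    have hpos := (hdensε (⌊T / ε⌋₊ - m) (by rw [hgrid]; exact hs m hm)).2 x (htube₁ m hm hx)
    rw [hn] at hpos ⊢
    exact JumpReversal.reversedJumpLaw_univ ε x₀ x n hpos.1.ne' hpos.2.ne
  have hexit := hXε.exit_le hρ hε hTstar.1.le (by linarith) (μ := μ) (φ := φ) (r := r) (w := w)
    hC hη0.le hκ hwl hprob
    (fun m hm x hx => (hG₁ε m (hm.trans hgap.le) x (htube₂ m hm hx)).trans_lt ENNReal.coe_lt_top)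
    (fun m hm x hx => (hdriftε m (hm.trans hgap.le) x (htube₂ m hm hx)).le)
    (fun m hm x hx => hG₂ε m (hm.trans hgap.le) x (htube₂ m hm hx))
    (fun s hs1 hs2 x hx => hlip s ⟨by linarith, hs2⟩ x (Metric.ball_subset_closedBall hx))
    (fun s hs1 hs2 => by
      have := hexp (s - ε) ⟨by linarith, by linarith⟩ s ⟨by linarith, hs2⟩ (by linarith)
        (by linarith)
      rwa [sub_sub_cancel] at this)
    (by
      have := huc T ⟨hT.le, le_rfl⟩ (T - JumpReversal.offset T ε) ⟨by linarith, by linarith⟩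
        (by rw [Real.dist_eq, sub_sub_cancel, abs_of_nonneg hΔ0]; linarith)
      rw [dist_eq_norm, hφ.finish] at this
      exact this.le.trans (min_le_right _ _)) hκηε.le
  refine le_trans (measure_mono (t := (JumpReversal.stayEvent (X ε)
    (fun m => φ (T - (JumpReversal.offset T ε + m * ε))) r
      ⌈(Tstar - JumpReversal.offset T ε) / ε⌉₊)ᶜ) fun ω hω => ?_) (le_trans ?_ hθ')
  · intro hstay
    refine not_le.2 hω (JumpReversal.iSup_reversedPath_le hT.le hε hrδ ?_ hstay)
    intro t ht u hut hu
    have hu2 := (abs_lt.1 hut).2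
    have := huc (T - u) ⟨by linarith [ht.2], by linarith⟩ (T - t)
      ⟨by linarith [ht.2, hTstar.2], by linarith [ht.1]⟩
      (by rw [Real.dist_eq, sub_sub_sub_cancel_left, abs_sub_comm]; linarith)
    rw [dist_eq_norm] at this
    exact this.le.trans (min_le_left _ _)
  · have hbound : Real.exp (2 * C * T) * ((1 + 4 * T) * η) = w * θ' := by
      rw [← mul_assoc, ← hB, hη]
      field_simp
    rw [hbound, ENNReal.ofReal_mul hw0.le] at hexit
    exact (ENNReal.mul_le_mul_iff_right (ENNReal.ofReal_pos.2 hw0).ne' ENNReal.ofReal_ne_top).1 hexit
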